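/- For a matrix $A_*\in\mathbb R^{d\times d}$ ($d\ge 1$) let $\rho(A_*)$ be its spectral radius, $\Gamma_t=\sum_{s=0}^{t-1}A_*^s(A_*^s)^\top$, and consider $X_0=0$, $X_{t+1}=A_*X_t+\eta_t$ with $\eta_0,\eta_1,\dots$ i.i.d. $\mathcal N(0,\sigma^2I_d)$, $\sigma>0$. Let $\widehat A(T)$ be an ordinary least squares estimator, i.e. a minimizer over $A\in\mathbb R^{d\times d}$ of $\sum_{t=1}^T\frac12\|X_{t+1}-AX_t\|_2^2$. For a constant $c_0>0$ call $k\in\{1,\dots,T\}$ an admissible block length (with constant $c_0$) for $(T,\delta)$ if $$\frac Tk\ \ge\ c_0\Big(d\log\frac d\delta+\log\det(\Gamma_T\Gamma_k^{-1})\Big).$$ There is a universal constant $C>0$ and, for every $c_0>0$, a constant $c>0$ depending only on $c_0$, such that the following holds for all $d\ge1$ and all $A_*\in\mathbb R^{d\times d}$ with $\rho(A_*)\le 1$ and (complex) Jordan decomposition $A_*=SJS^{-1}$, where $J$ has blocks of sizes $b_1,\dots,b_L$ and $\mathrm{cond}(S)=\sqrt{\lambda_{\max}(S^*S)/\lambda_{\min}(S^*S)}$.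 1. For all $T\in\mathbb N$, $\delta\in(0,1/2)$ and $k\in\{1,\dots,T\}$, $k$ is an admissible block length with constant $c_0$ for $(T,\delta)$ provided that $$\frac Tk\ \ge\ c\Big(d\log\frac{d\,\mathrm{cond}(S)\,T}{k\,\delta}+\log T\sum_{\ell:\,b_\ell\ge2}b_\ell^2\Big).$$ 2. For all $T\in\mathbb N$ and $\delta\in(0,1/2)$ with $$T\ \ge\ c\Big(d\log\frac{d\,\mathrm{cond}(S)}{\delta}+\Big(\sum_{\ell}b_\ell^2\Big)\log\Big(\sum_{\ell}b_\ell^2\Big)\Big),$$ $k=1$ is an admissible block length with constant $c_0$ for $(T,\delta)$ and, for every $\sigma>0$, with probability at least $1-\delta$, $$\|\widehat A(T)-A_*\|_{\mathrm{op}}\ \le\ C\sqrt{\frac{d\log(dT\,\mathrm{cond}(S)/\delta)+\log T\sum_{\ell:\,b_\ell\ge2}b_\ell^2}{T}}.$$ 3. Consequently ordinary least squares is consistent: for every $\sigma>0$, $\widehat A(T)\to A_*$ in probability as $T\to\infty$. -/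

import Mathlib

open MeasureTheory ProbabilityTheory Filter Topology

universe u

noncomputable section

/-- The upper triangular Jordan block of size `n` with eigenvalue `a`: `a` on the diagonal and `1`
on the superdiagonal. -/
def jordanBlock (n : ℕ) (a : ℂ) : Matrix (Fin n) (Fin n) ℂ :=
  Matrix.of fun i j => if i = j then a else if i.val + 1 = j.val then 1 else 0

/-- A (complex) Jordan decomposition `A = S * J * S⁻¹` of a real `d × d` matrix `A`, where `J` is
block diagonal with `L` Jordan blocks of sizes `b 0, …, b (L - 1)`. -/
structure JordanDecomposition {d : ℕ} (A : Matrix (Fin d) (Fin d) ℝ) where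
  /-- the number of Jordan blocks -/
  L : ℕ
  /-- the sizes of the Jordan blocks -/
  b : Fin L → ℕ
  b_pos : ∀ l, 0 < b l
  /-- the eigenvalues of the Jordan blocks -/
  a : Fin L → ℂ
  /-- the identification of the positions inside the blocks with the rows `0, …, d - 1` -/
  e : (Σ l, Fin (b l)) ≃ Fin d
  /-- the change of basis -/
  S : Matrix (Fin d) (Fin d) ℂ
  isUnit_S : IsUnit S
  eq : A.map (fun x : ℝ => (x : ℂ)) =
    S * Matrix.reindex e e (Matrix.blockDiagonal' fun l => jordanBlock (b l) (a l)) * S⁻¹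

/-- The condition number `sqrt (λ_max (S^* S) / λ_min (S^* S))` of a complex matrix. -/
def condNumber {d : ℕ} (S : Matrix (Fin d) (Fin d) ℂ) : ℝ :=
  Real.sqrt ((⨆ i, (Matrix.isHermitian_conjTranspose_mul_self S).eigenvalues i) /
    (⨅ i, (Matrix.isHermitian_conjTranspose_mul_self S).eigenvalues i))

/-- The sum of `b_l ^ 2` over all Jordan blocks. -/
def JordanDecomposition.sumSq {d : ℕ} {A : Matrix (Fin d) (Fin d) ℝ}
    (D : JordanDecomposition A) : ℝ :=
  ∑ l, (D.b l : ℝ) ^ 2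

/-- The sum of `b_l ^ 2` over the Jordan blocks of size at least `2`. -/
def JordanDecomposition.sumSqTwo {d : ℕ} {A : Matrix (Fin d) (Fin d) ℝ}
    (D : JordanDecomposition A) : ℝ :=
  ∑ l with 2 ≤ D.b l, (D.b l : ℝ) ^ 2

/-- The spectral radius of `A` (over `ℂ`) is at most `1`. -/
def MarginallyStable {d : ℕ} (A : Matrix (Fin d) (Fin d) ℝ) : Prop :=
  spectralRadius ℂ (A.map (fun x : ℝ => (x : ℂ))) ≤ 1

/-- The finite-time controllability Gramian `Γ_t = ∑_{s < t} A^s (A^s)ᵀ`. -/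
def gramian {d : ℕ} (A : Matrix (Fin d) (Fin d) ℝ) (t : ℕ) : Matrix (Fin d) (Fin d) ℝ :=
  ∑ s ∈ Finset.range t, A ^ s * (A ^ s).transpose

/-- The block length `k` satisfies, with constant `c₀`, the condition
`T / k ≥ c₀ (d log (d / δ) + log det (Γ_T Γ_k⁻¹))` on block lengths, where `1 ≤ k ≤ T`. -/
def IsAdmissibleBlockLength {d : ℕ} (c₀ : ℝ) (A : Matrix (Fin d) (Fin d) ℝ) (δ : ℝ) (T k : ℕ) :
    Prop :=
  1 ≤ k ∧ k ≤ T ∧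
    c₀ * (d * Real.log (d / δ) + Real.log (gramian A T * (gramian A k)⁻¹).det) ≤ (T : ℝ) / k

/-- The operator norm of a real matrix with respect to the Euclidean norm. -/
def opNorm {d : ℕ} (M : Matrix (Fin d) (Fin d) ℝ) : ℝ :=
  ‖Matrix.toEuclideanCLM (n := Fin d) (𝕜 := ℝ) M‖

/-- The noise vectors `η 0, η 1, …` are independent with law `N(0, σ² I)`. -/
structure IsGaussianNoise {d : ℕ} {Ω : Type u} [MeasurableSpace Ω] (P : Measure Ω) (σ : ℝ)
    (η : ℕ → Ω → EuclideanSpace ℝ (Fin d)) : Prop where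
  indep : iIndepFun η P
  law : ∀ t, HasLaw (η t) (multivariateGaussian 0 (σ ^ 2 • (1 : Matrix (Fin d) (Fin d) ℝ))) P

/-- The state `X_t` of the system `X_{t+1} = A X_t + η_t`, `X_0 = 0`. -/
def state {d : ℕ} {Ω : Type u} (A : Matrix (Fin d) (Fin d) ℝ)
    (η : ℕ → Ω → EuclideanSpace ℝ (Fin d)) : ℕ → Ω → EuclideanSpace ℝ (Fin d)
  | 0 => fun _ => 0
  | t + 1 => fun ω => Matrix.toEuclideanCLM (n := Fin d) (𝕜 := ℝ) A (state A η t ω) + η t ω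

/-- `B` is an ordinary least squares estimate from the trajectory `x 1, …, x (T + 1)`: it minimizes
`∑_{t=1}^T ½ ‖x_{t+1} - B x_t‖²` over all `d × d` matrices. -/
def IsOLS {d : ℕ} (x : ℕ → EuclideanSpace ℝ (Fin d)) (T : ℕ) (B : Matrix (Fin d) (Fin d) ℝ) :
    Prop :=
  IsMinOn (fun M : Matrix (Fin d) (Fin d) ℝ => ∑ t ∈ Finset.Icc 1 T,
    (1 / 2 : ℝ) * ‖x (t + 1) - Matrix.toEuclideanCLM (n := Fin d) (𝕜 := ℝ) M (x t)‖ ^ 2)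
    Set.univ B

end

/-! The Gramian ratio is computed in Jordan coordinates. With `A = S J S⁻¹`, `Γ_t` equals `S (∑ J^s
(Sᴴ S)⁻¹ (J^s)ᴴ) Sᴴ`. Since `(Sᴴ S)⁻¹` lies between `1/λ_max` and `1/λ_min`, monotonicity of the
determinant replaces it by the identity at the price `cond(S)^(2d)`, and `|det S|²` cancels in the
ratio. The Gramian of `J` splits over the blocks. A block of size one contributes at most `T/k`,
because `∑ |a|^(2s)` has decreasing terms; a block of size `b ≥ 2` contributes at most `T^(3b²)`, by
polynomial growth of its powers, AM–GM, and the fact that its determinant at time `k` is at least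
`1`. This is `JordanDecomposition.det_gramian_ratio`; its logarithm gives the block length
condition, and `exists_burnIn_constant` removes `log T` from the right-hand side when `k = 1`.

For the error bound the noise is scaled to unit variance. The process `exp (∑ ⟪y, Z_t⟫ ⟪u, g_t⟫ - ½
⟪y, Z_t⟫²)` has mean one for every `y`; integrating it over `y` against a Gaussian weight and
applying Markov's inequality bounds the noise sum relative to `κ I + ∑ Z_t Z_tᵀ`. The determinant of
that matrix is controlled by Markov's inequality for its trace normalized by `Γ_T`, and a net in `u`
makes the bound vectorial: `IsStdNoise.measure_not_selfNormalized_le`.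

This bound is used twice. With `Z_t = A X_t` and noise `g_t` it controls the cross terms of `∑ ⟪w, A
X_t + g_t⟫²`, so that the covariance of the noise alone already forces the empirical covariance
above `T/4`; hence block length one suffices. With `Z_t = X_{t+1}` and noise `g_{t+1}` it enters the
normal equations in `IsOLS.opNorm_sub_le`. Consistency is the same rate at a fixed confidence level,
since `log T / T → 0`. -/

/-! ### Determinants of positive semidefinite matrices -/

open scoped ComplexOrder Matrix MatrixOrder in
theorem Matrix.PosSemidef.exists_eq_conjTranspose_mul_self {𝕜 n : Type*} [RCLike 𝕜] [Fintype n]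
    {M : Matrix n n 𝕜} (hM : M.PosSemidef) : ∃ R : Matrix n n 𝕜, M = Rᴴ * R := by
  classical
  exact CStarAlgebra.nonneg_iff_eq_star_mul_self.mp hM.nonneg

-- AM–GM for the eigenvalues.
open scoped ComplexOrder Matrix in
theorem Matrix.PosSemidef.re_det_le_pow {𝕜 n : Type*} [RCLike 𝕜] [Fintype n] [DecidableEq n]
    [Nonempty n] {M : Matrix n n 𝕜} (hM : M.PosSemidef) {B : ℝ}
    (hB : RCLike.re M.trace ≤ Fintype.card n * B) :
    RCLike.re M.det ≤ B ^ Fintype.card n := by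
  have hn : (0 : ℝ) < Fintype.card n := by exact_mod_cast Fintype.card_pos
  have h0 := fun i => hM.eigenvalues_nonneg i
  rw [hM.1.trace_eq_sum_eigenvalues, ← RCLike.ofReal_sum, RCLike.ofReal_re] at hB
  rw [hM.1.det_eq_prod_eigenvalues, ← RCLike.ofReal_prod, RCLike.ofReal_re]
  have key := Real.geom_mean_le_arith_mean_weighted Finset.univ
    (fun _ : n => (Fintype.card n : ℝ)⁻¹) hM.1.eigenvalues (fun _ _ => by positivity)
    (by simp [hn.ne']) (fun i _ => h0 i)
  rw [← Finset.mul_sum, Real.finsetProd_rpow _ _ (fun i _ => h0 i)] at key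
  have hP : 0 ≤ ∏ i, hM.1.eigenvalues i := Finset.prod_nonneg fun i _ => h0 i
  have h2 : (∏ i, hM.1.eigenvalues i) ^ ((Fintype.card n : ℝ)⁻¹) ≤ B := by
    refine key.trans ?_
    rw [inv_mul_le_iff₀ hn]; exact hB
  calc ∏ i, hM.1.eigenvalues i
      = ((∏ i, hM.1.eigenvalues i) ^ ((Fintype.card n : ℝ)⁻¹)) ^ Fintype.card n := by
        rw [Real.rpow_inv_natCast_pow hP (Fintype.card_ne_zero)]
    _ ≤ _ := by gcongr

open scoped ComplexOrder Matrix in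
theorem Matrix.PosSemidef.one_le_re_det_one_add {𝕜 n : Type*} [RCLike 𝕜] [Fintype n]
    [DecidableEq n] {C : Matrix n n 𝕜} (hC : C.PosSemidef) :
    1 ≤ RCLike.re (1 + C).det := by
  have hs := hC.1.spectral_theorem
  set U := hC.1.eigenvectorUnitary
  have h1 : (1 + C) = (U : Matrix n n 𝕜) *
      (1 + Matrix.diagonal (RCLike.ofReal ∘ hC.1.eigenvalues)) * star (U : Matrix n n 𝕜) := by
    conv_lhs => rw [hs]
    rw [Unitary.conjStarAlgAut_apply, mul_add, add_mul, mul_one]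
    simp
  have h2 : (1 + C).det = ∏ i, ((1 + hC.1.eigenvalues i : ℝ) : 𝕜) := by
    rw [h1, Matrix.det_mul_right_comm]
    rw [show (U : Matrix n n 𝕜) * star (U : Matrix n n 𝕜) = 1 by simp, one_mul,
      ← Matrix.diagonal_one, Matrix.diagonal_add, Matrix.det_diagonal]
    simp
  rw [h2, ← RCLike.ofReal_prod, RCLike.ofReal_re]
  exact Finset.one_le_prod fun i _ => by linarith [hC.eigenvalues_nonneg i]

-- Factor `A = Rᴴ R` with `R` invertible; then `B = Rᴴ (1 + C) R` with `C` positive semidefinite,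
-- and `det (1 + C) ≥ 1`.
open scoped ComplexOrder Matrix in
theorem Matrix.PosDef.re_det_le_re_det {𝕜 n : Type*} [RCLike 𝕜] [Fintype n]
    [DecidableEq n] {A B : Matrix n n 𝕜} (hA : A.PosDef) (hAB : (B - A).PosSemidef) :
    RCLike.re A.det ≤ RCLike.re B.det := by
  obtain ⟨R, hR⟩ := hA.posSemidef.exists_eq_conjTranspose_mul_self
  have hdet : IsUnit R.det := by
    have := (Matrix.isUnit_iff_isUnit_det _).mp hA.isUnit
    rw [hR, Matrix.det_mul] at this
    exact isUnit_of_mul_isUnit_right this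
  have hRu : IsUnit R := (Matrix.isUnit_iff_isUnit_det _).mpr hdet
  set C := (R⁻¹)ᴴ * (B - A) * R⁻¹
  have hC : C.PosSemidef := hAB.conjTranspose_mul_mul_same _
  have hB : B = Rᴴ * (1 + C) * R := by
    have h1 : R⁻¹ * R = 1 := Matrix.nonsing_inv_mul _ hdet
    have h2 : Rᴴ * (R⁻¹)ᴴ = 1 := by rw [← Matrix.conjTranspose_mul, h1]; simp
    have : Rᴴ * C * R = B - A := by
      calc Rᴴ * C * R = (Rᴴ * (R⁻¹)ᴴ) * (B - A) * (R⁻¹ * R) := by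
            simp only [C, Matrix.mul_assoc]
        _ = _ := by rw [h1, h2]; simp
    rw [mul_add, add_mul, this, mul_one, ← hR]; abel
  have hd : B.det = A.det * (1 + C).det := by
    rw [hB, hR]; simp only [Matrix.det_mul]; ring
  have hApos := RCLike.pos_iff.mp hA.det_pos
  rw [hd, RCLike.mul_re, hApos.2, zero_mul, sub_zero]
  exact le_mul_of_one_le_right hApos.1.le hC.one_le_re_det_one_add

/-! ### Powers and Gramians of a single Jordan block -/

theorem jordanBlock_mul_apply {n : ℕ} (a : ℂ) (M : Matrix (Fin n) (Fin n) ℂ) (i j : Fin n) :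
    (M * jordanBlock n a) i j = a * M i j +
      if h : 0 < j.val then M i ⟨j - 1, by omega⟩ else 0 := by
  have h1 : ∀ x, M i x * jordanBlock n a x j = (if x = j then a * M i j else 0) +
      (if x.val + 1 = j.val then M i x else 0) := by
    intro x
    simp only [jordanBlock, Matrix.of_apply]
    by_cases hx : x = j
    · subst hx; simp [mul_comm]
    · by_cases hx' : x.val + 1 = j.val <;> simp [hx, hx']
  rw [Matrix.mul_apply, Finset.sum_congr rfl fun x _ => h1 x, Finset.sum_add_distrib]
  congr 1
  · simp
  · split_ifs with h
    · rw [Finset.sum_eq_single (⟨j - 1, by omega⟩ : Fin n)]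
      · rw [if_pos]; simp; omega
      · intro b _ hb
        rw [if_neg]; intro hb'; apply hb; ext; simp; omega
      · simp
    · apply Finset.sum_eq_zero; intro x _; rw [if_neg]; omega

/-- Multiplying by the block adds to `a` times each entry its left neighbour, so the entries obey
Pascal's recursion. The power of `s` is a crude form of the binomial coefficient and survives the
induction because `s^(m+1) + s^m ≤ (s+1)^(m+1)`. -/
theorem norm_jordanBlock_pow_apply_le {n : ℕ} {a : ℂ} (ha : ‖a‖ ≤ 1) (s : ℕ) (i j : Fin n) :
    ‖(jordanBlock n a ^ s) i j‖ ≤ if i ≤ j then (s : ℝ) ^ (j.val - i.val) else 0 := by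
  induction s generalizing j with
  | zero =>
    rw [pow_zero, Matrix.one_apply]
    rcases lt_trichotomy i j with h | h | h
    · rw [if_neg h.ne, norm_zero]; split_ifs <;> positivity
    · subst h; simp
    · rw [if_neg h.ne', norm_zero]; split_ifs <;> positivity
  | succ s ih =>
    rw [pow_succ, jordanBlock_mul_apply]
    refine (norm_add_le _ _).trans ?_
    have h1 : ‖a * (jordanBlock n a ^ s) i j‖ ≤ if i ≤ j then (s : ℝ) ^ (j.val - i.val) else 0 := by
      rw [norm_mul]
      exact (mul_le_of_le_one_left (norm_nonneg _) ha).trans (ih j)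
    rcases lt_trichotomy i j with h | h | h
    · have hj : 0 < j.val := lt_of_le_of_lt (Nat.zero_le _) h
      rw [dif_pos hj]
      have h2 := ih ⟨j - 1, by omega⟩
      have hij : i.val < j.val := h
      rw [if_pos (show i ≤ (⟨j - 1, by omega⟩ : Fin n) from Fin.le_def.mpr (by simp; omega))] at h2
      rw [if_pos h.le] at h1 ⊢
      obtain ⟨m, hm⟩ : ∃ m, j.val - i.val = m + 1 := ⟨j.val - i.val - 1, by omega⟩
      have hm' : j.val - 1 - i.val = m := by omega
      simp only [hm, hm'] at h1 h2 ⊢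
      have h3 : (s : ℝ) ^ m ≤ (s + 1 : ℝ) ^ m := by gcongr; linarith
      have : ((s + 1 : ℕ) : ℝ) ^ (m + 1) = s * (s + 1 : ℝ) ^ m + (s + 1 : ℝ) ^ m := by
        push_cast; ring
      rw [this]
      have h4 : (s : ℝ) ^ (m + 1) ≤ s * (s + 1 : ℝ) ^ m := by
        rw [pow_succ']; gcongr
      linarith
    · subst h
      rw [if_pos le_rfl] at h1 ⊢
      have : ‖(if h : 0 < i.val then (jordanBlock n a ^ s) i ⟨i - 1, by omega⟩ else 0 : ℂ)‖ ≤ 0 := by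
        split_ifs with h
        · have := ih ⟨i - 1, by omega⟩
          rwa [if_neg] at this
          rw [Fin.le_def]; simp; omega
        · simp
      simp at h1 ⊢
      linarith
    · rw [if_neg (not_le.mpr h)] at h1 ⊢
      have : ‖(if h : 0 < j.val then (jordanBlock n a ^ s) i ⟨j - 1, by omega⟩ else 0 : ℂ)‖ ≤ 0 := by
        split_ifs with h'
        · have := ih ⟨j - 1, by omega⟩
          rwa [if_neg] at this
          have : j.val < i.val := h
          rw [Fin.le_def]; simp; omega
        · simp
      linarith

open scoped Matrix in
/-- The complex Gramian `∑_{s < t} M^s (M^s)ᴴ`. -/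
def complexGramian {n : Type*} [Fintype n] [DecidableEq n] (M : Matrix n n ℂ) (t : ℕ) :
    Matrix n n ℂ :=
  ∑ s ∈ Finset.range t, M ^ s * (M ^ s)ᴴ

section
open scoped ComplexOrder Matrix

theorem posSemidef_complexGramian {n : Type*} [Fintype n] [DecidableEq n] (M : Matrix n n ℂ)
    (t : ℕ) : (complexGramian M t).PosSemidef :=
  Matrix.posSemidef_sum _ fun _ _ => Matrix.posSemidef_self_mul_conjTranspose _

theorem complexGramian_succ' {n : Type*} [Fintype n] [DecidableEq n] (M : Matrix n n ℂ) (t : ℕ) :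
    complexGramian M (t + 1) = 1 + M * complexGramian M t * Mᴴ := by
  rw [complexGramian, Finset.sum_range_succ', complexGramian, Finset.mul_sum, Finset.sum_mul]
  simp [pow_succ', Matrix.conjTranspose_mul, Matrix.mul_assoc, add_comm, -Matrix.conjTranspose_pow]

theorem posDef_complexGramian {n : Type*} [Fintype n] [DecidableEq n] (M : Matrix n n ℂ)
    {t : ℕ} (ht : 1 ≤ t) : (complexGramian M t).PosDef := by
  obtain ⟨t, rfl⟩ := Nat.exists_eq_add_of_le' ht
  rw [complexGramian_succ']
  exact Matrix.PosDef.one.add_posSemidef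
    ((posSemidef_complexGramian M t).mul_mul_conjTranspose_same M)

theorem one_le_re_det_complexGramian {n : Type*} [Fintype n] [DecidableEq n] (M : Matrix n n ℂ)
    {t : ℕ} (ht : 1 ≤ t) : 1 ≤ (complexGramian M t).det.re := by
  obtain ⟨t, rfl⟩ := Nat.exists_eq_add_of_le' ht
  rw [complexGramian_succ']
  exact ((posSemidef_complexGramian M t).mul_mul_conjTranspose_same M).one_le_re_det_one_add

theorem Matrix.PosSemidef.ofReal_re_det {n : Type*} [Fintype n] [DecidableEq n] {M : Matrix n n ℂ}
    (hM : M.PosSemidef) : (M.det.re : ℂ) = M.det := by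
  have := Complex.le_def.mp hM.det_nonneg
  apply Complex.ext <;> simp [← this.2]

theorem re_trace_complexGramian {n : Type*} [Fintype n] [DecidableEq n] (M : Matrix n n ℂ)
    (t : ℕ) : (complexGramian M t).trace.re = ∑ s ∈ Finset.range t, ∑ i, ∑ j, ‖(M ^ s) i j‖ ^ 2 := by
  simp only [complexGramian, Matrix.trace, Matrix.diag, Matrix.sum_apply, Matrix.mul_apply,
    Matrix.conjTranspose_apply, Complex.re_sum]
  rw [Finset.sum_comm]
  refine Finset.sum_congr rfl fun s _ => Finset.sum_congr rfl fun i _ =>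
    Finset.sum_congr rfl fun j _ => ?_
  rw [Complex.star_def, Complex.mul_conj, Complex.ofReal_re, Complex.normSq_eq_norm_sq]

/-- The trace is a sum of `T n²` squared entries, each at most `T^(2(n-1))`. Together with `n ≤ T^n`
this makes the mean eigenvalue at most `T^(3n)`, and AM–GM raises it to the power `n`. -/
theorem re_det_complexGramian_jordanBlock_le {n : ℕ} (hn : 0 < n) {a : ℂ} (ha : ‖a‖ ≤ 1) {T : ℕ}
    (hT : 1 ≤ T) : (complexGramian (jordanBlock n a) T).det.re ≤ (T : ℝ) ^ (3 * n ^ 2) := by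
  -- `T = 1` is separate because `n ≤ 2^n ≤ T^n` below needs `T ≥ 2`.
  rcases hT.eq_or_lt with rfl | hT
  · simp [complexGramian]
  have : Nonempty (Fin n) := ⟨⟨0, hn⟩⟩
  have hT1 : (1 : ℝ) ≤ T := by exact_mod_cast hT.le
  have hterm : ∀ s ∈ Finset.range T, ∀ i j, ‖(jordanBlock n a ^ s) i j‖ ^ 2 ≤
      ((T : ℝ) ^ (n - 1)) ^ 2 := by
    intro s hs i j
    refine pow_le_pow_left₀ (norm_nonneg _) ((norm_jordanBlock_pow_apply_le ha s i j).trans ?_) 2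
    split_ifs
    · have : (s : ℝ) ≤ T := by exact_mod_cast (Finset.mem_range.mp hs).le
      calc (s : ℝ) ^ (j.val - i.val) ≤ (T : ℝ) ^ (j.val - i.val) := by gcongr
        _ ≤ _ := pow_le_pow_right₀ hT1 (by omega)
    · positivity
  have htr : (complexGramian (jordanBlock n a) T).trace.re ≤
      Fintype.card (Fin n) * (T : ℝ) ^ (3 * n) := by
    rw [re_trace_complexGramian]
    calc _ ≤ ∑ s ∈ Finset.range T, ∑ i : Fin n, ∑ j : Fin n, ((T : ℝ) ^ (n - 1)) ^ 2 :=
          Finset.sum_le_sum fun s hs => Finset.sum_le_sum fun i _ => Finset.sum_le_sum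
            fun j _ => hterm s hs i j
      _ = n * (n * (T * ((T : ℝ) ^ (n - 1)) ^ 2)) := by simp; ring
      _ ≤ n * (T ^ n * (T * ((T : ℝ) ^ (n - 1)) ^ 2)) := by
          gcongr
          exact_mod_cast (Nat.lt_two_pow_self (n := n)).le.trans (Nat.pow_le_pow_left hT n)
      _ ≤ n * T ^ (3 * n) := by
          gcongr
          rw [← pow_mul, ← pow_succ', ← pow_add]
          exact pow_le_pow_right₀ hT1 (by omega)
      _ = _ := by simp
  refine ((posSemidef_complexGramian _ T).re_det_le_pow htr).trans (le_of_eq ?_)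
  rw [← pow_mul, Fintype.card_fin]; ring_nf

/-- Each term added after time `k` is at most `f k`, hence at most the average of the first `k`
terms. -/
theorem sum_range_antitone_le {f : ℕ → ℝ} (hf : Antitone f) {k T : ℕ}
    (hk : 1 ≤ k) (hkT : k ≤ T) :
    ∑ s ∈ Finset.range T, f s ≤ (T / k : ℝ) * ∑ s ∈ Finset.range k, f s := by
  have hk0 : (0 : ℝ) < k := by exact_mod_cast hk
  have h1 : (k : ℝ) * f k ≤ ∑ s ∈ Finset.range k, f s := by
    have := Finset.card_nsmul_le_sum (Finset.range k) f (f k)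
      (fun x hx => hf (Finset.mem_range.mp hx).le)
    simpa using this
  induction T, hkT using Nat.le_induction with
  | base => rw [div_self hk0.ne', one_mul]
  | succ T hT ih =>
    rw [Finset.sum_range_succ]
    have h2 : f T ≤ f k := hf hT
    have h3 : f k ≤ (∑ s ∈ Finset.range k, f s) / k := by
      rw [le_div_iff₀ hk0]; linarith
    calc _ ≤ (T / k : ℝ) * ∑ s ∈ Finset.range k, f s + (∑ s ∈ Finset.range k, f s) / k := by
          linarith
      _ = _ := by push_cast; ring

/-- The Gramian is the scalar `∑ |a|^(2s)`. No power of `T` is lost beyond `T/k`, which is why only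
blocks of size at least two enter the `log T` term. -/
theorem re_det_complexGramian_jordanBlock_one_le {n : ℕ} (hn : n = 1) {a : ℂ} (ha : ‖a‖ ≤ 1)
    {k T : ℕ} (hk : 1 ≤ k) (hkT : k ≤ T) :
    (complexGramian (jordanBlock n a) T).det.re ≤
      (T / k : ℝ) * (complexGramian (jordanBlock n a) k).det.re := by
  subst hn
  have h : ∀ t, (complexGramian (jordanBlock 1 a) t).det.re =
      ∑ s ∈ Finset.range t, (‖a‖ ^ s) ^ 2 := by
    intro t
    have h1 : ∀ s, (jordanBlock 1 a ^ s) 0 0 = a ^ s := by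
      intro s
      induction s with
      | zero => simp
      | succ s ih =>
        rw [pow_succ, Matrix.mul_apply, Fin.sum_univ_one, ih, pow_succ]
        simp [jordanBlock]
    have h2 := re_trace_complexGramian (jordanBlock 1 a) t
    rw [Matrix.det_unique]
    rw [Matrix.trace_fin_one] at h2
    simp [h1] at h2
    simpa using h2
  rw [h, h]
  refine sum_range_antitone_le (antitone_nat_of_succ_le fun s => ?_) hk hkT
  exact pow_le_pow_left₀ (by positivity)
    (pow_le_pow_of_le_one (norm_nonneg _) ha (Nat.le_succ s)) 2

theorem re_det_complexGramian_jordanBlock_ratio {n : ℕ} (hn : 0 < n) {a : ℂ} (ha : ‖a‖ ≤ 1)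
    {k T : ℕ} (hk : 1 ≤ k) (hkT : k ≤ T) :
    (complexGramian (jordanBlock n a) T).det.re ≤
      (T / k : ℝ) * (T : ℝ) ^ (3 * if 2 ≤ n then n ^ 2 else 0) *
        (complexGramian (jordanBlock n a) k).det.re := by
  have hk0 : (0 : ℝ) < k := by exact_mod_cast hk
  split_ifs with h
  · have h1 : (1 : ℝ) ≤ T / k := by rw [one_le_div hk0]; exact_mod_cast hkT
    have h2 := one_le_re_det_complexGramian (jordanBlock n a) hk
    calc _ ≤ (T : ℝ) ^ (3 * n ^ 2) := re_det_complexGramian_jordanBlock_le hn ha (hk.trans hkT)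
      _ = 1 * (T : ℝ) ^ (3 * n ^ 2) * 1 := by ring
      _ ≤ _ := by gcongr
  · simpa using re_det_complexGramian_jordanBlock_one_le (by omega) ha hk hkT

end

/-! ### Reduction of the Gramian to Jordan coordinates -/

section
open scoped ComplexOrder Matrix

theorem complexGramian_blockDiagonal' {L : ℕ} {b : Fin L → ℕ}
    (M : ∀ l, Matrix (Fin (b l)) (Fin (b l)) ℂ) (t : ℕ) :
    complexGramian (Matrix.blockDiagonal' M) t =
      Matrix.blockDiagonal' fun l => complexGramian (M l) t := by
  induction t with
  | zero => simp only [complexGramian, Finset.range_zero, Finset.sum_empty];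
            exact Matrix.blockDiagonal'_zero.symm
  | succ t ih =>
    rw [complexGramian, Finset.sum_range_succ, ← complexGramian, ih, ← Matrix.blockDiagonal'_pow,
      Matrix.blockDiagonal'_conjTranspose, ← Matrix.blockDiagonal'_mul,
      ← Matrix.blockDiagonal'_add]
    congr 1
    ext1 l
    simp [complexGramian, Finset.sum_range_succ]

theorem complexGramian_reindex {m n : Type*} [Fintype m] [DecidableEq m] [Fintype n]
    [DecidableEq n] (e : m ≃ n) (M : Matrix m m ℂ) (t : ℕ) :
    complexGramian (Matrix.reindex e e M) t = Matrix.reindex e e (complexGramian M t) := by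
  have hp : ∀ s, Matrix.reindex e e M ^ s = Matrix.reindex e e (M ^ s) := fun s =>
    (map_pow (Matrix.reindexAlgEquiv ℂ ℂ e) M s).symm
  have hs : ∀ f : ℕ → Matrix m m ℂ, Matrix.reindex e e (∑ s ∈ Finset.range t, f s) =
      ∑ s ∈ Finset.range t, Matrix.reindex e e (f s) := fun f =>
    map_sum (Matrix.reindexAlgEquiv ℂ ℂ e) f _
  rw [complexGramian, complexGramian, hs]
  refine Finset.sum_congr rfl fun s _ => ?_
  rw [hp, Matrix.conjTranspose_reindex]
  exact (map_mul (Matrix.reindexAlgEquiv ℂ ℂ e) _ _).symm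

theorem map_gramian {d : ℕ} (A : Matrix (Fin d) (Fin d) ℝ) (t : ℕ) :
    (gramian A t).map (fun x : ℝ => (x : ℂ)) =
      complexGramian (A.map fun x : ℝ => (x : ℂ)) t := by
  have h1 : ∀ M : Matrix (Fin d) (Fin d) ℝ, M.map (fun x : ℝ => (x : ℂ)) =
    (Complex.ofRealHom).mapMatrix M := fun M => rfl
  rw [gramian, complexGramian, h1, h1, map_sum]
  refine Finset.sum_congr rfl fun s _ => ?_
  rw [map_mul, map_pow]
  congr 1
  ext i j
  rw [Matrix.conjTranspose_apply, ← map_pow]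
  simp [-Matrix.transpose_pow]

/-- `S` maps the first basis vector of the block to an eigenvector of `A`, so the diagonal value
lies in the spectrum. -/
theorem JordanDecomposition.norm_a_le_one {d : ℕ} {A : Matrix (Fin d) (Fin d) ℝ}
    (hA : MarginallyStable A) (D : JordanDecomposition A) (l : Fin D.L) : ‖D.a l‖ ≤ 1 := by
  set J := Matrix.reindex D.e D.e (Matrix.blockDiagonal' fun l => jordanBlock (D.b l) (D.a l))
    with hJ
  set i₀ : Fin d := D.e ⟨l, ⟨0, D.b_pos l⟩⟩
  have hJe : J *ᵥ Pi.single i₀ 1 = D.a l • Pi.single i₀ 1 := by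
    ext i
    rw [Matrix.mulVec_single_one]
    obtain ⟨⟨l', p⟩, rfl⟩ := D.e.surjective i
    simp only [hJ, Matrix.col_apply, Matrix.reindex_apply, Matrix.submatrix_apply,
      Equiv.symm_apply_apply, i₀, Pi.smul_apply, Pi.single_apply, D.e.injective.eq_iff]
    by_cases hl : l' = l
    · subst hl
      rw [Matrix.blockDiagonal'_apply_eq]
      by_cases hp : p = ⟨0, D.b_pos l'⟩
      · subst hp; simp [jordanBlock]
      · simp [jordanBlock, hp]
    · rw [Matrix.blockDiagonal'_apply_ne _ _ _ hl, if_neg]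
      · simp
      · intro h; exact hl (congrArg Sigma.fst h)
  have hSd : IsUnit D.S.det := (Matrix.isUnit_iff_isUnit_det _).mp D.isUnit_S
  have hmem : D.a l ∈ spectrum ℂ (A.map fun x : ℝ => (x : ℂ)) := by
    rw [spectrum.mem_iff]
    intro hu
    have hinj := Matrix.mulVec_injective_iff_isUnit.mpr hu
    have hz : (algebraMap ℂ (Matrix (Fin d) (Fin d) ℂ) (D.a l) - A.map fun x : ℝ => (x : ℂ)) *ᵥ
        (D.S *ᵥ Pi.single i₀ 1) = 0 := by
      rw [D.eq, Matrix.sub_mulVec, ← hJ, Matrix.mulVec_mulVec, Matrix.mulVec_mulVec,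
        Matrix.mul_assoc, Matrix.nonsing_inv_mul _ hSd, Matrix.mul_one,
        ← Matrix.mulVec_mulVec _ D.S J, hJe,
        Algebra.algebraMap_eq_smul_one, Matrix.smul_mul, Matrix.one_mul, Matrix.mulVec_smul,
        Matrix.smul_mulVec, sub_self]
    have h0 : D.S *ᵥ Pi.single i₀ 1 = 0 := hinj (by rw [hz, Matrix.mulVec_zero])
    have h1 : (Pi.single i₀ 1 : Fin d → ℂ) = 0 :=
      Matrix.mulVec_injective_iff_isUnit.mpr D.isUnit_S (by rw [h0, Matrix.mulVec_zero])
    simpa using congrFun h1 i₀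
  have h := (le_iSup₂ (f := fun (k : ℂ) (_ : k ∈ spectrum ℂ (A.map fun x : ℝ => (x : ℂ))) =>
    (‖k‖₊ : ENNReal)) (D.a l) hmem).trans hA
  exact_mod_cast h

/-- A single eigenbasis serves every `c`, so both the lower and the upper Loewner bound on `M⁻¹`
become scalar inequalities between eigenvalues. -/
theorem Matrix.PosDef.inv_sub_smul_one {n : Type*} [Fintype n] [DecidableEq n]
    {M : Matrix n n ℂ} (hM : M.PosDef) :
    ∃ U : Matrix n n ℂ, ∀ c : ℝ, M⁻¹ - (c : ℂ) • (1 : Matrix n n ℂ) =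
      U * Matrix.diagonal (fun i => (((hM.1.eigenvalues i)⁻¹ - c : ℝ) : ℂ)) * Uᴴ := by
  have hs := hM.1.spectral_theorem
  set U := hM.1.eigenvectorUnitary
  have hUU : (U : Matrix n n ℂ) * star (U : Matrix n n ℂ) = 1 := by simp
  have hUU' : star (U : Matrix n n ℂ) * (U : Matrix n n ℂ) = 1 := by simp
  refine ⟨U, fun c => ?_⟩
  have hinv : M⁻¹ = (U : Matrix n n ℂ) *
      Matrix.diagonal (fun i => (((hM.1.eigenvalues i)⁻¹ : ℝ) : ℂ)) *
      star (U : Matrix n n ℂ) := by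
    apply Matrix.inv_eq_right_inv
    rw [Unitary.conjStarAlgAut_apply] at hs
    set E := Matrix.diagonal (RCLike.ofReal (K := ℂ) ∘ hM.1.eigenvalues)
    set F := Matrix.diagonal (fun i => (((hM.1.eigenvalues i)⁻¹ : ℝ) : ℂ))
    have hEF : E * F = 1 := by
      rw [Matrix.diagonal_mul_diagonal, ← Matrix.diagonal_one]
      congr 1; ext i
      have := (hM.eigenvalues_pos i).ne'
      simp [this]
    calc M * ((U : Matrix n n ℂ) * F * star (U : Matrix n n ℂ))
      _ = (U : Matrix n n ℂ) * E * star (U : Matrix n n ℂ) * ((U : Matrix n n ℂ) * F *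
        star (U : Matrix n n ℂ)) := congrArg (· * _) hs
      _ = (U : Matrix n n ℂ) * E * (star (U : Matrix n n ℂ) *
        (U : Matrix n n ℂ)) * F * star (U : Matrix n n ℂ) := by simp only [Matrix.mul_assoc]
      _ = (U : Matrix n n ℂ) * (E * F) * star (U : Matrix n n ℂ) := by
        rw [hUU', Matrix.mul_one, Matrix.mul_assoc _ E F]
      _ = 1 := by rw [hEF, Matrix.mul_one, hUU]
  have hone : (c : ℂ) • (1 : Matrix n n ℂ) = (U : Matrix n n ℂ) *
      Matrix.diagonal (fun _ => (c : ℂ)) * star (U : Matrix n n ℂ) := by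
    rw [← Matrix.smul_one_eq_diagonal]; simp
  rw [hinv, hone, ← Matrix.sub_mul, ← Matrix.mul_sub, Matrix.diagonal_sub]
  simp [Matrix.star_eq_conjTranspose]

theorem posSemidef_sum_conj {n : Type*} [Fintype n] [DecidableEq n] (J N : Matrix n n ℂ) (c : ℝ)
    (hN : (N - (c : ℂ) • (1 : Matrix n n ℂ)).PosSemidef) (t : ℕ) :
    ((∑ s ∈ Finset.range t, J ^ s * N * (J ^ s)ᴴ) - (c : ℂ) • complexGramian J t).PosSemidef := by
  rw [complexGramian, Finset.smul_sum, ← Finset.sum_sub_distrib]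
  refine Matrix.posSemidef_sum _ fun s _ => ?_
  convert hN.mul_mul_conjTranspose_same (J ^ s) using 1
  simp [Matrix.mul_sub, Matrix.sub_mul]

theorem posSemidef_conj_sum {n : Type*} [Fintype n] [DecidableEq n] (J N : Matrix n n ℂ) (c : ℝ)
    (hN : ((c : ℂ) • (1 : Matrix n n ℂ) - N).PosSemidef) (t : ℕ) :
    ((c : ℂ) • complexGramian J t - ∑ s ∈ Finset.range t, J ^ s * N * (J ^ s)ᴴ).PosSemidef := by
  rw [complexGramian, Finset.smul_sum, ← Finset.sum_sub_distrib]
  refine Matrix.posSemidef_sum _ fun s _ => ?_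
  convert hN.mul_mul_conjTranspose_same (J ^ s) using 1
  simp [Matrix.mul_sub, Matrix.sub_mul]

/-- The powers are `S J^s S⁻¹`, and the inner factors combine to `S⁻¹ (S⁻¹)ᴴ = (Sᴴ S)⁻¹`; the
dependence on `S` that does not cancel in a determinant ratio is confined to this matrix. -/
theorem complexGramian_conj {n : Type*} [Fintype n] [DecidableEq n] (S J : Matrix n n ℂ)
    (hS : IsUnit S) (t : ℕ) :
    complexGramian (S * J * S⁻¹) t =
      S * (∑ s ∈ Finset.range t, J ^ s * (Sᴴ * S)⁻¹ * (J ^ s)ᴴ) * Sᴴ := by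
  have hSd : IsUnit S.det := (Matrix.isUnit_iff_isUnit_det _).mp hS
  rw [complexGramian, Finset.mul_sum, Finset.sum_mul]
  have hp : ∀ s, (S * J * S⁻¹) ^ s = S * J ^ s * S⁻¹ := by
    intro s
    induction s with
    | zero => simp [Matrix.mul_nonsing_inv _ hSd]
    | succ s ih =>
      rw [pow_succ, ih, pow_succ]
      calc S * J ^ s * S⁻¹ * (S * J * S⁻¹) = S * J ^ s * (S⁻¹ * S) * J * S⁻¹ := by
            simp only [Matrix.mul_assoc]
        _ = _ := by rw [Matrix.nonsing_inv_mul _ hSd, Matrix.mul_one]; simp only [Matrix.mul_assoc]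
  refine Finset.sum_congr rfl fun s _ => ?_
  rw [hp, Matrix.mul_inv_rev, Matrix.conjTranspose_mul, Matrix.conjTranspose_mul,
    Matrix.conjTranspose_nonsing_inv]
  simp only [Matrix.mul_assoc]

end

/-! ### The determinant ratio of two Gramians -/

section
open scoped ComplexOrder Matrix

theorem Matrix.det_blockDiagonal'_fin {L : ℕ} {b : Fin L → ℕ}
    (M : ∀ l, Matrix (Fin (b l)) (Fin (b l)) ℂ) :
    (Matrix.blockDiagonal' M).det = ∏ l, (M l).det := by
  rw [(Matrix.blockTriangular_blockDiagonal' M).det_fintype]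
  refine Finset.prod_congr rfl fun l _ => ?_
  rw [← Matrix.det_submatrix_equiv_self (Equiv.sigmaSubtype l).symm]
  congr 1
  ext i j
  simp [Matrix.toSquareBlock_def, Equiv.sigmaSubtype, Matrix.blockDiagonal'_apply_eq]

theorem ofReal_det_gramian {d : ℕ} (A : Matrix (Fin d) (Fin d) ℝ) (t : ℕ) :
    (((gramian A t).det : ℝ) : ℂ) = (complexGramian (A.map fun x : ℝ => (x : ℂ)) t).det := by
  rw [← map_gramian]
  exact Complex.ofRealHom.map_det (gramian A t)

theorem det_gramian_eq {d : ℕ} (A : Matrix (Fin d) (Fin d) ℝ) (t : ℕ) :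
    (gramian A t).det = (complexGramian (A.map fun x : ℝ => (x : ℂ)) t).det.re := by
  rw [← ofReal_det_gramian, Complex.ofReal_re]

theorem one_le_det_gramian {d : ℕ} (A : Matrix (Fin d) (Fin d) ℝ) {t : ℕ} (ht : 1 ≤ t) :
    1 ≤ (gramian A t).det := by
  rw [det_gramian_eq]; exact one_le_re_det_complexGramian _ ht

theorem det_gramian_mono {d : ℕ} (A : Matrix (Fin d) (Fin d) ℝ) {k T : ℕ} (hk : 1 ≤ k)
    (hkT : k ≤ T) : (gramian A k).det ≤ (gramian A T).det := by
  rw [det_gramian_eq, det_gramian_eq]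
  refine (posDef_complexGramian _ hk).re_det_le_re_det ?_
  rw [complexGramian, complexGramian, ← Finset.sum_range_add_sum_Ico _ hkT, add_sub_cancel_left]
  exact Matrix.posSemidef_sum _ fun _ _ => Matrix.posSemidef_self_mul_conjTranspose _

theorem det_gramian_mul_inv {d : ℕ} (A : Matrix (Fin d) (Fin d) ℝ) (k T : ℕ) :
    (gramian A T * (gramian A k)⁻¹).det = (gramian A T).det / (gramian A k).det := by
  rw [Matrix.det_mul, Matrix.det_nonsing_inv, Ring.inverse_eq_inv', div_eq_mul_inv]

theorem one_le_det_gramian_mul_inv {d : ℕ} (A : Matrix (Fin d) (Fin d) ℝ) {k T : ℕ} (hk : 1 ≤ k)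
    (hkT : k ≤ T) : 1 ≤ (gramian A T * (gramian A k)⁻¹).det := by
  rw [det_gramian_mul_inv, one_le_div (zero_lt_one.trans_le (one_le_det_gramian A hk))]
  exact det_gramian_mono A hk hkT

theorem JordanDecomposition.posDef_conjTranspose_mul_self {d : ℕ} {A : Matrix (Fin d) (Fin d) ℝ}
    (D : JordanDecomposition A) : (D.Sᴴ * D.S).PosDef :=
  Matrix.PosDef.conjTranspose_mul_self _ (Matrix.mulVec_injective_iff_isUnit.mpr D.isUnit_S)

theorem JordanDecomposition.sum_b {d : ℕ} {A : Matrix (Fin d) (Fin d) ℝ}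
    (D : JordanDecomposition A) : ∑ l, D.b l = d := by
  simpa using Fintype.card_congr D.e

theorem JordanDecomposition.L_le {d : ℕ} {A : Matrix (Fin d) (Fin d) ℝ}
    (D : JordanDecomposition A) : D.L ≤ d := by
  calc D.L = ∑ _l : Fin D.L, 1 := by simp
    _ ≤ ∑ l, D.b l := Finset.sum_le_sum fun l _ => D.b_pos l
    _ = d := D.sum_b

/-- The determinant is multiplicative over blocks, and there are at most `d` factors `T/k`. -/
theorem JordanDecomposition.re_det_blocks_ratio {d : ℕ} {A : Matrix (Fin d) (Fin d) ℝ}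
    (hA : MarginallyStable A) (D : JordanDecomposition A) {k T : ℕ} (hk : 1 ≤ k) (hkT : k ≤ T) :
    (complexGramian (Matrix.reindex D.e D.e
      (Matrix.blockDiagonal' fun l => jordanBlock (D.b l) (D.a l))) T).det.re ≤
    (T / k : ℝ) ^ d * (T : ℝ) ^ (3 * ∑ l with 2 ≤ D.b l, D.b l ^ 2) *
      (complexGramian (Matrix.reindex D.e D.e
        (Matrix.blockDiagonal' fun l => jordanBlock (D.b l) (D.a l))) k).det.re := by
  have hk0 : (0 : ℝ) < k := by exact_mod_cast hk
  have h1 : (1 : ℝ) ≤ T / k := by rw [one_le_div hk0]; exact_mod_cast hkT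
  have hprod : ∀ t, (complexGramian (Matrix.reindex D.e D.e
      (Matrix.blockDiagonal' fun l => jordanBlock (D.b l) (D.a l))) t).det.re =
      ∏ l, (complexGramian (jordanBlock (D.b l) (D.a l)) t).det.re := by
    intro t
    rw [complexGramian_reindex, Matrix.det_reindex_self, complexGramian_blockDiagonal',
      Matrix.det_blockDiagonal'_fin, Finset.prod_congr rfl fun l _ =>
        ((posSemidef_complexGramian (jordanBlock (D.b l) (D.a l)) t).ofReal_re_det).symm,
      ← Complex.ofReal_prod, Complex.ofReal_re]
  rw [hprod, hprod]
  have hnn : ∀ t l, 0 ≤ (complexGramian (jordanBlock (D.b l) (D.a l)) t).det.re := fun t l =>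
    (Complex.le_def.mp (posSemidef_complexGramian _ t).det_nonneg).1
  calc _ ≤ ∏ l, ((T / k : ℝ) * (T : ℝ) ^ (3 * if 2 ≤ D.b l then D.b l ^ 2 else 0) *
        (complexGramian (jordanBlock (D.b l) (D.a l)) k).det.re) :=
        Finset.prod_le_prod (fun l _ => hnn T l) fun l _ =>
          re_det_complexGramian_jordanBlock_ratio (D.b_pos l) (D.norm_a_le_one hA l) hk hkT
    _ = (T / k : ℝ) ^ D.L * (T : ℝ) ^ (3 * ∑ l with 2 ≤ D.b l, D.b l ^ 2) *
        ∏ l, (complexGramian (jordanBlock (D.b l) (D.a l)) k).det.re := by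
        rw [Finset.prod_mul_distrib, Finset.prod_mul_distrib, Finset.prod_const,
          Finset.prod_pow_eq_pow_sum, ← Finset.mul_sum, ← Finset.sum_filter]
        simp
    _ ≤ _ := by
        gcongr
        · exact Finset.prod_nonneg fun l _ => hnn k l
        · exact D.L_le

/-- The witnesses `a` and `b` are the extreme eigenvalues of `Sᴴ S`. -/
theorem condNumber_pos_aux {d : ℕ} (hd : 1 ≤ d) {S : Matrix (Fin d) (Fin d) ℂ}
    (hS : (Sᴴ * S).PosDef) :
    ∃ a b : ℝ, 0 < a ∧ 0 < b ∧ a ≤ b ∧ condNumber S ^ 2 = b / a ∧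
      (∀ i, a ≤ hS.1.eigenvalues i) ∧ ∀ i, hS.1.eigenvalues i ≤ b := by
  have : Nonempty (Fin d) := ⟨⟨0, hd⟩⟩
  obtain ⟨i, hi⟩ := exists_eq_ciInf_of_finite (f := hS.1.eigenvalues)
  have ha := hS.eigenvalues_pos i
  have h1 : ∀ i, (⨅ i, hS.1.eigenvalues i) ≤ hS.1.eigenvalues i := fun i =>
    ciInf_le (Set.finite_range _).bddBelow i
  have h2 : ∀ i, hS.1.eigenvalues i ≤ ⨆ i, hS.1.eigenvalues i := fun i =>
    le_ciSup (Set.finite_range _).bddAbove i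
  rw [hi] at ha
  have hab := (h1 i).trans (h2 i)
  refine ⟨_, _, ha, ha.trans_le hab, hab, ?_, h1, h2⟩
  rw [condNumber, Real.sq_sqrt]
  exact div_nonneg (ha.le.trans hab) ha.le

theorem JordanDecomposition.one_le_condNumber {d : ℕ} (hd : 1 ≤ d)
    {A : Matrix (Fin d) (Fin d) ℝ} (D : JordanDecomposition A) : 1 ≤ condNumber D.S := by
  obtain ⟨a, b, ha, hb, hab, hc, -, -⟩ := condNumber_pos_aux hd D.posDef_conjTranspose_mul_self
  have h1 : 1 ≤ condNumber D.S ^ 2 := by rw [hc, one_le_div ha]; exact hab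
  have h0 : 0 ≤ condNumber D.S := Real.sqrt_nonneg _
  nlinarith

/-- Replacing `(Sᴴ S)⁻¹` by `a⁻¹` in the numerator and by `b⁻¹` in the denominator costs `(b/a)^d =
cond(S)^(2d)`; what remains is the ratio for the Jordan form itself. -/
theorem JordanDecomposition.det_gramian_ratio {d : ℕ} (hd : 1 ≤ d)
    {A : Matrix (Fin d) (Fin d) ℝ}
    (hA : MarginallyStable A) (D : JordanDecomposition A) {k T : ℕ} (hk : 1 ≤ k) (hkT : k ≤ T) :
    (gramian A T * (gramian A k)⁻¹).det ≤
      condNumber D.S ^ (2 * d) * (T / k : ℝ) ^ d *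
        (T : ℝ) ^ (3 * ∑ l with 2 ≤ D.b l, D.b l ^ 2) := by
  obtain ⟨a, b, ha, hb, -, hc, h1, h2⟩ := condNumber_pos_aux hd D.posDef_conjTranspose_mul_self
  set J := Matrix.reindex D.e D.e (Matrix.blockDiagonal' fun l => jordanBlock (D.b l) (D.a l))
    with hJ
  set N := (D.Sᴴ * D.S)⁻¹ with hN
  set G := fun t : ℕ => ∑ s ∈ Finset.range t, J ^ s * N * (J ^ s)ᴴ with hG
  obtain ⟨U, hU⟩ := D.posDef_conjTranspose_mul_self.inv_sub_smul_one
  have hev := D.posDef_conjTranspose_mul_self.eigenvalues_pos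
  have hlow : (N - ((b⁻¹ : ℝ) : ℂ) • (1 : Matrix (Fin d) (Fin d) ℂ)).PosSemidef := by
    rw [hN, hU]
    refine Matrix.PosSemidef.mul_mul_conjTranspose_same (Matrix.PosSemidef.diagonal fun i => ?_) _
    have h3 : (0 : ℂ) ≤ (((D.posDef_conjTranspose_mul_self.1.eigenvalues i)⁻¹ - b⁻¹ : ℝ) : ℂ) := by
      exact_mod_cast sub_nonneg.mpr (inv_anti₀ (hev i) (h2 i))
    exact h3
  have hupp : (((a⁻¹ : ℝ) : ℂ) • (1 : Matrix (Fin d) (Fin d) ℂ) - N).PosSemidef := by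
    rw [← neg_sub, hN, hU, ← Matrix.neg_mul, ← Matrix.mul_neg, Matrix.diagonal_neg]
    refine Matrix.PosSemidef.mul_mul_conjTranspose_same (Matrix.PosSemidef.diagonal fun i => ?_) _
    have := inv_anti₀ ha (h1 i)
    have h3 : 0 ≤ -((D.posDef_conjTranspose_mul_self.1.eigenvalues i)⁻¹ - a⁻¹) := by linarith
    have h4 : (0 : ℂ) ≤ ((-((D.posDef_conjTranspose_mul_self.1.eigenvalues i)⁻¹ - a⁻¹) : ℝ) : ℂ) := by
      exact_mod_cast h3
    simpa using h4
  have hsm : ∀ (c : ℝ) (t : ℕ), (((c : ℂ) • complexGramian J t).det).re =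
      c ^ d * (complexGramian J t).det.re := by
    intro c t
    rw [Matrix.det_smul, Fintype.card_fin, ← Complex.ofReal_pow, Complex.re_ofReal_mul]
  have hpd : ∀ t, 1 ≤ t → (((b⁻¹ : ℝ) : ℂ) • complexGramian J t).PosDef := fun t ht =>
    (posDef_complexGramian J ht).smul (by exact_mod_cast inv_pos.mpr hb)
  have hGlow : ∀ t, 1 ≤ t → b⁻¹ ^ d * (complexGramian J t).det.re ≤ (G t).det.re := by
    intro t ht
    rw [← hsm]
    exact (hpd t ht).re_det_le_re_det (posSemidef_sum_conj J N b⁻¹ hlow t)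
  have hGpd : ∀ t, 1 ≤ t → (G t).PosDef := by
    intro t ht
    have := (hpd t ht).add_posSemidef (posSemidef_sum_conj J N b⁻¹ hlow t)
    rwa [add_sub_cancel] at this
  have hGupp : ∀ t, 1 ≤ t → (G t).det.re ≤ a⁻¹ ^ d * (complexGramian J t).det.re := by
    intro t ht
    rw [← hsm]
    exact (hGpd t ht).re_det_le_re_det (posSemidef_conj_sum J N a⁻¹ hupp t)
  have hdet : ∀ t, (gramian A t).det = ‖D.S.det‖ ^ 2 * (G t).det.re := by
    intro t
    rw [det_gramian_eq, D.eq, complexGramian_conj _ _ D.isUnit_S, Matrix.det_mul, Matrix.det_mul,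
      Matrix.det_conjTranspose, mul_right_comm, Complex.star_def, Complex.mul_conj,
      Complex.normSq_eq_norm_sq, Complex.re_ofReal_mul]
  have hSd : 0 < ‖D.S.det‖ ^ 2 := by
    have := ((Matrix.isUnit_iff_isUnit_det _).mp D.isUnit_S).ne_zero
    positivity
  have hrk : 0 < (complexGramian J k).det.re :=
    zero_lt_one.trans_le (one_le_re_det_complexGramian J hk)
  have hgk : 0 < (G k).det.re := lt_of_lt_of_le (by positivity) (hGlow k hk)
  rw [det_gramian_mul_inv, hdet, hdet, mul_div_mul_left _ _ hSd.ne', div_le_iff₀ hgk]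
  have hkey := D.re_det_blocks_ratio hA hk hkT
  rw [← hJ] at hkey
  set Q := (T / k : ℝ) ^ d * (T : ℝ) ^ (3 * ∑ l with 2 ≤ D.b l, D.b l ^ 2)
  have hQ : 0 ≤ Q := by positivity
  calc (G T).det.re ≤ a⁻¹ ^ d * (complexGramian J T).det.re := hGupp T (hk.trans hkT)
    _ ≤ a⁻¹ ^ d * (Q * (complexGramian J k).det.re) := by gcongr
    _ = (b / a) ^ d * Q * (b⁻¹ ^ d * (complexGramian J k).det.re) := by
        rw [div_eq_mul_inv, mul_pow]
        have : b ^ d * b⁻¹ ^ d = 1 := by rw [← mul_pow, mul_inv_cancel₀ hb.ne', one_pow]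
        linear_combination -(a⁻¹ ^ d * Q * (complexGramian J k).det.re) * this
    _ ≤ (b / a) ^ d * Q * (G k).det.re := by gcongr; exact hGlow k hk
    _ = _ := by rw [pow_mul, hc]; simp only [Q]; ring

end

/-! ### The block length condition and the burn-in time -/

theorem JordanDecomposition.log_det_gramian_le {d : ℕ} (hd : 1 ≤ d)
    {A : Matrix (Fin d) (Fin d) ℝ}
    (hA : MarginallyStable A) (D : JordanDecomposition A) {k T : ℕ} (hk : 1 ≤ k) (hkT : k ≤ T) :
    Real.log (gramian A T * (gramian A k)⁻¹).det ≤
      2 * d * Real.log (condNumber D.S) + d * Real.log (T / k) + 3 * (Real.log T * D.sumSqTwo) := by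
  have hk0 : (0 : ℝ) < k := by exact_mod_cast hk
  have hT0 : (0 : ℝ) < T := by exact_mod_cast hk.trans hkT
  have hc := zero_lt_one.trans_le (D.one_le_condNumber hd)
  refine (Real.log_le_log (zero_lt_one.trans_le (one_le_det_gramian_mul_inv A hk hkT))
    (D.det_gramian_ratio hd hA hk hkT)).trans (le_of_eq ?_)
  rw [Real.log_mul (by positivity) (by positivity), Real.log_mul (by positivity) (by positivity),
    Real.log_pow, Real.log_pow, Real.log_pow, JordanDecomposition.sumSqTwo]
  push_cast
  ring

/-- `d log (d / δ) + log det (Γ_T Γ_k⁻¹)`, the right-hand side of the block length condition. -/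
noncomputable def blockComplexity {d : ℕ} (A : Matrix (Fin d) (Fin d) ℝ) (δ : ℝ) (T k : ℕ) : ℝ :=
  d * Real.log (d / δ) + Real.log (gramian A T * (gramian A k)⁻¹).det

/-- The factor `3` is the largest coefficient in `log_det_gramian_le`, inherited from the exponent
`3 b²`; the other terms have coefficients at most `2`. -/
theorem JordanDecomposition.blockComplexity_le {d : ℕ} (hd : 1 ≤ d)
    {A : Matrix (Fin d) (Fin d) ℝ} (hA : MarginallyStable A) (D : JordanDecomposition A)
    {k T : ℕ} (hk : 1 ≤ k) (hkT : k ≤ T) {δ : ℝ} (hδ : 0 < δ) (hδ' : δ < 1 / 2) :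
    blockComplexity A δ T k ≤
      3 * (d * Real.log (d * condNumber D.S * T / (k * δ)) + Real.log T * D.sumSqTwo) := by
  have hk0 : (0 : ℝ) < k := by exact_mod_cast hk
  have hT0 : (0 : ℝ) < T := by exact_mod_cast hk.trans hkT
  have hd1 : (1 : ℝ) ≤ d := by exact_mod_cast hd
  have hc1 := D.one_le_condNumber hd
  have hc := zero_lt_one.trans_le hc1
  have h1 : (1 : ℝ) ≤ T / k := by rw [one_le_div hk0]; exact_mod_cast hkT
  have e1 : Real.log (d * condNumber D.S * T / (k * δ)) =
      Real.log (d / δ) + Real.log (condNumber D.S) + Real.log (T / k) := by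
    rw [← Real.log_mul (by positivity) (by positivity),
      ← Real.log_mul (by positivity) (by positivity)]
    congr 1
    field_simp
  have h2 := D.log_det_gramian_le hd hA hk hkT
  have h3 : 0 ≤ Real.log (d / δ) := Real.log_nonneg (by rw [one_le_div hδ]; linarith)
  have h4 := Real.log_nonneg hc1
  have h5 := Real.log_nonneg h1
  rw [e1, blockComplexity]
  nlinarith [mul_nonneg (zero_le_one.trans hd1) h3, mul_nonneg (zero_le_one.trans hd1) h4,
    mul_nonneg (zero_le_one.trans hd1) h5]

theorem isAdmissibleBlockLength_of_mul_le {d : ℕ} (hd : 1 ≤ d) {A : Matrix (Fin d) (Fin d) ℝ}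
    (hA : MarginallyStable A) (D : JordanDecomposition A) {c₀ c : ℝ} (hc₀ : 0 < c₀)
    (hc : 3 * c₀ ≤ c) {T k : ℕ} {δ : ℝ} (hδ : 0 < δ) (hδ' : δ < 1 / 2)
    (hk : 1 ≤ k) (hkT : k ≤ T)
    (h : c * (d * Real.log (d * condNumber D.S * T / (k * δ)) + Real.log T * D.sumSqTwo)
      ≤ (T : ℝ) / k) : IsAdmissibleBlockLength c₀ A δ T k := by
  refine ⟨hk, hkT, le_trans ?_ h⟩
  have hk0 : (0 : ℝ) < k := by exact_mod_cast hk
  have hT1 : (1 : ℝ) ≤ T := by exact_mod_cast hk.trans hkT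
  have hd1 : (1 : ℝ) ≤ d := by exact_mod_cast hd
  have hc1 := D.one_le_condNumber hd
  have hTk : (k : ℝ) ≤ T := by exact_mod_cast hkT
  have hlog : 0 ≤ Real.log (d * condNumber D.S * T / (k * δ)) := by
    apply Real.log_nonneg
    rw [one_le_div (by positivity)]
    calc (k : ℝ) * δ ≤ T * 1 := by gcongr; linarith
      _ = 1 * 1 * T := by ring
      _ ≤ _ := by gcongr
  have hnn : 0 ≤ d * Real.log (d * condNumber D.S * T / (k * δ)) + Real.log T * D.sumSqTwo := by
    have := Real.log_nonneg hT1
    have : 0 ≤ D.sumSqTwo := Finset.sum_nonneg fun _ _ => by positivity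
    positivity
  set R := d * Real.log (d * condNumber D.S * T / (k * δ)) + Real.log T * D.sumSqTwo
  calc _ = c₀ * blockComplexity A δ T k := rfl
    _ ≤ c₀ * (3 * R) := by gcongr; exact D.blockComplexity_le hd hA hk hkT hδ hδ'
    _ = 3 * c₀ * R := by ring
    _ ≤ c * R := by gcongr

theorem JordanDecomposition.sumSqTwo_le_sumSq {d : ℕ} {A : Matrix (Fin d) (Fin d) ℝ}
    (D : JordanDecomposition A) : D.sumSqTwo ≤ D.sumSq :=
  Finset.sum_le_sum_of_subset_of_nonneg (Finset.filter_subset _ _) fun _ _ _ => by positivity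

theorem JordanDecomposition.le_sumSq {d : ℕ} {A : Matrix (Fin d) (Fin d) ℝ}
    (D : JordanDecomposition A) : (d : ℝ) ≤ D.sumSq := by
  rw [JordanDecomposition.sumSq]
  calc (d : ℝ) = ∑ l, (D.b l : ℝ) := by exact_mod_cast D.sum_b.symm
    _ ≤ _ := Finset.sum_le_sum fun l _ => by
      have : (1 : ℝ) ≤ D.b l := by exact_mod_cast D.b_pos l
      nlinarith

theorem JordanDecomposition.sumSq_eq_one_or_two_le {d : ℕ} (hd : 1 ≤ d)
    {A : Matrix (Fin d) (Fin d) ℝ} (D : JordanDecomposition A) : D.sumSq = 1 ∨ 2 ≤ D.sumSq := by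
  have h : D.sumSq = ((∑ l, D.b l ^ 2 : ℕ) : ℝ) := by simp [JordanDecomposition.sumSq]
  have h1 := D.le_sumSq
  rw [h] at h1 ⊢
  have h2 : d ≤ ∑ l, D.b l ^ 2 := by exact_mod_cast h1
  rcases (hd.trans h2).eq_or_lt with h3 | h3
  · left; rw [← h3]; simp
  · right; exact_mod_cast h3

/-- The logarithm vanishes when the sum of squares is `1`, where `x` has to pay. Being an integer,
the sum is otherwise at least `2`, and its logarithm exceeds `1/2`. -/
theorem JordanDecomposition.sumSq_le_mul {d : ℕ} (hd : 1 ≤ d) {A : Matrix (Fin d) (Fin d) ℝ}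
    (D : JordanDecomposition A) {x : ℝ} (hx : 1 / 2 ≤ x) :
    D.sumSq ≤ 4 * (x + D.sumSq * Real.log D.sumSq) := by
  rcases D.sumSq_eq_one_or_two_le hd with h | h
  · rw [h]; simp; linarith
  · have h1 : (1 : ℝ) / 2 ≤ Real.log D.sumSq :=
      le_trans (by linarith [Real.log_two_gt_d9]) (Real.log_le_log (by norm_num) h)
    nlinarith

theorem Real.log_le_div_add_log {x m : ℝ} (hx : 0 < x) (hm : 0 < m) :
    Real.log x ≤ x / m + Real.log m := by
  have h := Real.log_le_sub_one_of_pos (div_pos hx hm)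
  rw [Real.log_div hx.ne' hm.ne'] at h
  linarith

theorem JordanDecomposition.half_le_log {d : ℕ} (hd : 1 ≤ d)
    {A : Matrix (Fin d) (Fin d) ℝ} (D : JordanDecomposition A) {δ : ℝ} (hδ : 0 < δ)
    (hδ' : δ < 1 / 2) : 1 / 2 ≤ d * Real.log (d * condNumber D.S / δ) := by
  have hd1 : (1 : ℝ) ≤ d := by exact_mod_cast hd
  have hc1 := D.one_le_condNumber hd
  have h2 : (2 : ℝ) ≤ d * condNumber D.S / δ := by
    rw [le_div_iff₀ hδ]; nlinarith
  have := Real.log_le_log (by norm_num) h2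
  nlinarith [Real.log_two_gt_d9]

/-- A burn-in time of order `d log (d cond / δ) + q log q`, where `q = ∑ b_l ^ 2`, absorbs the
logarithmic factors in the time horizon. -/
theorem exists_burnIn_constant {c₁ : ℝ} (hc₁ : 0 < c₁) : ∃ c : ℝ, 0 < c ∧
    ∀ (d : ℕ), 1 ≤ d → ∀ (A : Matrix (Fin d) (Fin d) ℝ) (D : JordanDecomposition A)
      (T : ℕ) (δ : ℝ), 0 < δ → δ < 1 / 2 →
      c * (d * Real.log (d * condNumber D.S / δ) + D.sumSq * Real.log D.sumSq) ≤ (T : ℝ) →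
      1 ≤ T ∧ c₁ * (d * Real.log (d * condNumber D.S * T / δ) + Real.log T * D.sumSqTwo) ≤ T := by
  -- Chosen so that `2 c₁ T / m ≤ T / 2`: half of `T` absorbs the linear error terms, and the
  -- burn-in assumption pays for the rest with the other half.
  set m := 4 * c₁ + 1 with hm
  have hm0 : 0 < m := by positivity
  have hlm : 0 ≤ Real.log m := Real.log_nonneg (by linarith)
  refine ⟨2 * (c₁ * (3 + 8 * Real.log m)), by positivity, ?_⟩
  intro d hd A D T δ hδ hδ' h
  have hx := D.half_le_log hd hδ hδ'
  set q := D.sumSq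
  set x := d * Real.log (d * condNumber D.S / δ) with hxdef
  have hq4 := D.sumSq_le_mul hd hx
  have hd1 : (1 : ℝ) ≤ d := by exact_mod_cast hd
  have hdq := D.le_sumSq
  have hq1 : 1 ≤ q := hd1.trans hdq
  have hq0 : 0 < q := by linarith
  have hqlog : 0 ≤ q * Real.log q := mul_nonneg hq0.le (Real.log_nonneg hq1)
  set U := x + q * Real.log q
  have hU : 1 / 2 ≤ U := by simp only [U]; linarith
  have hTpos : (0 : ℝ) < T := lt_of_lt_of_le (by positivity) h
  have hT : 1 ≤ T := by exact_mod_cast hTpos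
  refine ⟨hT, ?_⟩
  have hT1 : (1 : ℝ) ≤ T := by exact_mod_cast hT
  have hlT := Real.log_nonneg hT1
  have hc := zero_lt_one.trans_le (D.one_le_condNumber hd)
  have e1 : Real.log (d * condNumber D.S * T / δ) =
      Real.log (d * condNumber D.S / δ) + Real.log T := by
    rw [← Real.log_mul (by positivity) (by positivity)]; congr 1; ring
  -- Split `log T = log q + log (T/q)` and bound the second logarithm linearly; the first one is the
  -- source of `q log q` in the burn-in.
  have e2 : q * Real.log T ≤ q * Real.log q + (T / m + q * Real.log m) := by
    have h1 := Real.log_le_div_add_log (div_pos hTpos hq0) hm0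
    rw [Real.log_div hTpos.ne' hq0.ne'] at h1
    have h2 : q * (T / q / m) = T / m := by field_simp
    have h3 := mul_le_mul_of_nonneg_left h1 hq0.le
    rw [mul_sub, mul_add, h2] at h3
    linarith
  have e3 : d * Real.log T ≤ q * Real.log T := by gcongr
  have e4 : Real.log T * D.sumSqTwo ≤ q * Real.log T := by
    rw [mul_comm]; gcongr; exact D.sumSqTwo_le_sumSq
  have e5 : 2 * (c₁ * (T / m)) ≤ T / 2 := by
    rw [hm, ← sub_nonneg]
    have : (T : ℝ) / 2 - 2 * (c₁ * (T / (4 * c₁ + 1))) = T / (2 * (4 * c₁ + 1)) := by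
      field_simp; ring
    rw [this]; positivity
  have e6 : q * Real.log m ≤ 4 * U * Real.log m := by gcongr
  have e7 : d * Real.log (d * condNumber D.S * T / δ) + Real.log T * D.sumSqTwo ≤
      U * (3 + 8 * Real.log m) + 2 * (T / m) := by
    rw [e1, mul_add, ← hxdef]
    have : x + q * Real.log q = U := rfl
    nlinarith
  calc _ ≤ c₁ * (U * (3 + 8 * Real.log m) + 2 * (T / m)) := by gcongr
    _ = (2 * (c₁ * (3 + 8 * Real.log m)) * U) / 2 + 2 * (c₁ * (T / m)) := by ring
    _ ≤ T := by linarith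

/-! ### Nets on the sphere and quadratic forms -/

section
variable {E : Type*} [NormedAddCommGroup E] [InnerProductSpace ℝ E]

variable (E) [FiniteDimensional ℝ E] in
/-- The unit sphere of a Euclidean space of dimension `n` has a `1 / 2`-net of at most `5 ^ n`
points. -/
theorem exists_half_net_sphere : ∃ N : Finset E, N.card ≤ 5 ^ Module.finrank ℝ E ∧
    (∀ u ∈ N, ‖u‖ = 1) ∧ ∀ v : E, ‖v‖ = 1 → ∃ u ∈ N, ‖v - u‖ ≤ 1 / 2 := by
  classical
  -- A `1/2`-separated set of maximal cardinality is a net: a point far from all of it could be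
  -- added.
  let Q : ℕ → Prop := fun n => ∃ N : Finset E, N.card = n ∧ (∀ u ∈ N, ‖u‖ = 1) ∧
    ∀ u ∈ N, ∀ w ∈ N, u ≠ w → 1 / 2 ≤ ‖u - w‖
  have hbound : ∀ n, Q n → n ≤ 5 ^ Module.finrank ℝ E := by
    rintro n ⟨N, rfl, h1, h2⟩
    -- Doubling turns the set into a `1`-separated subset of the ball of radius `2`, the
    -- normalization of `Besicovitch.card_le_of_separated`.
    have hinj : Function.Injective fun x : E => (2 : ℝ) • x := smul_right_injective E two_ne_zero
    rw [← Finset.card_image_of_injective N hinj]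
    apply Besicovitch.card_le_of_separated
    · simp only [Finset.mem_image, forall_exists_index, and_imp, forall_apply_eq_imp_iff₂]
      intro u hu
      rw [norm_smul, h1 u hu]; norm_num
    · simp only [Finset.mem_image, forall_exists_index, and_imp, forall_apply_eq_imp_iff₂]
      intro u hu w hw huw
      have := h2 u hu w hw (fun h => huw (by rw [h]))
      rw [← smul_sub, norm_smul, Real.norm_ofNat]; linarith
  have h0 : Q 0 := ⟨∅, by simp⟩
  obtain ⟨N, hcard, h1, h2⟩ := Nat.findGreatest_spec (P := Q) (Nat.zero_le (5 ^ Module.finrank ℝ E)) h0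
  refine ⟨N, hbound _ ⟨N, rfl, h1, h2⟩, h1, fun v hv => ?_⟩
  by_contra! hcon
  have hvN : v ∉ N := fun hvN => by have := hcon v hvN; simp at this; linarith
  have hQ : Q (N.card + 1) := by
    refine ⟨insert v N, Finset.card_insert_of_notMem hvN, ?_, ?_⟩
    · intro u hu
      rcases Finset.mem_insert.mp hu with rfl | hu
      exacts [hv, h1 u hu]
    · intro u hu w hw huw
      rcases Finset.mem_insert.mp hu with rfl | hu' <;>
        rcases Finset.mem_insert.mp hw with rfl | hw'
      · exact absurd rfl huw
      · exact (hcon w hw').le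
      · rw [norm_sub_rev]; exact (hcon u hu').le
      · exact h2 u hu' w hw' huw
  have := Nat.le_findGreatest (hbound _ hQ) hQ
  omega

/-- Testing `y` against a net point close to its direction gives `‖y‖ ≤ β + ‖y‖ / 2`. -/
theorem norm_le_two_mul_of_half_net {N : Finset E}
    (hN : ∀ v : E, ‖v‖ = 1 → ∃ u ∈ N, ‖v - u‖ ≤ 1 / 2) {y : E} {β : ℝ} (hβ : 0 ≤ β)
    (h : ∀ u ∈ N, |inner ℝ y u| ≤ β) : ‖y‖ ≤ 2 * β := by
  rcases eq_or_ne y 0 with rfl | hy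
  · simpa using hβ
  have hy' : ‖y‖ ≠ 0 := norm_ne_zero_iff.mpr hy
  obtain ⟨u, hu, huv⟩ := hN (‖y‖⁻¹ • y) (by rw [norm_smul, norm_inv, norm_norm, inv_mul_cancel₀ hy'])
  have h1 : inner ℝ y (‖y‖⁻¹ • y) = ‖y‖ := by
    rw [real_inner_smul_right, real_inner_self_eq_norm_sq]; field_simp
  have h2 : inner ℝ y (‖y‖⁻¹ • y) = inner ℝ y u + inner ℝ y (‖y‖⁻¹ • y - u) := by
    rw [← inner_add_right, add_sub_cancel]
  have h3 := (le_abs_self _).trans (abs_real_inner_le_norm y (‖y‖⁻¹ • y - u))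
  have h4 := (le_abs_self _).trans (h u hu)
  have h5 : ‖y‖ * ‖‖y‖⁻¹ • y - u‖ ≤ ‖y‖ * (1 / 2) := by gcongr
  linarith

/-- Let `y` be the symmetric operator `∑ g_t g_tᵀ - |I|`. Polarization turns the bounds at `u ± w`
into `|⟪y u, w⟫| ≤ |I| / 8` on the net, and each of the two arguments loses a factor `2` when
passing to the whole space, so `‖y v‖ ≤ (|I| / 2) ‖v‖`. -/
theorem sum_inner_sq_ge_of_half_net {N : Finset E}
    (hN1 : ∀ u ∈ N, ‖u‖ = 1) (hN : ∀ v : E, ‖v‖ = 1 → ∃ u ∈ N, ‖v - u‖ ≤ 1 / 2)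
    {ι : Type*} (I : Finset ι) (g : ι → E)
    (h : ∀ u ∈ N, ∀ w ∈ N, ∀ x ∈ ({u + w, u - w} : Set E),
      |∑ t ∈ I, inner ℝ x (g t) ^ 2 - I.card * ‖x‖ ^ 2| ≤ 1 / 8 * I.card * ‖x‖ ^ 2) (v : E) :
    1 / 2 * I.card * ‖v‖ ^ 2 ≤ ∑ t ∈ I, inner ℝ v (g t) ^ 2 := by
  set y : E → E := fun v => ∑ t ∈ I, inner ℝ v (g t) • g t - (I.card : ℝ) • v with hy
  have hin : ∀ v w, inner ℝ (y v) w =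
      ∑ t ∈ I, inner ℝ v (g t) * inner ℝ w (g t) - I.card * inner ℝ v w := by
    intro v w
    simp only [hy, inner_sub_left, sum_inner, real_inner_smul_left]
    simp only [real_inner_comm]
  have hsymm : ∀ v w, inner ℝ (y v) w = inner ℝ (y w) v := by
    intro v w
    rw [hin, hin, real_inner_comm]; congr 1
    exact Finset.sum_congr rfl fun _ _ => mul_comm _ _
  have hpol : ∀ u w, inner ℝ (y u) w =
      ((∑ t ∈ I, inner ℝ (u + w) (g t) ^ 2 - I.card * ‖u + w‖ ^ 2) -
        (∑ t ∈ I, inner ℝ (u - w) (g t) ^ 2 - I.card * ‖u - w‖ ^ 2)) / 4 := by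
    intro u w
    have h1 : ∑ t ∈ I, inner ℝ u (g t) * inner ℝ w (g t) =
        (∑ t ∈ I, inner ℝ (u + w) (g t) ^ 2 - ∑ t ∈ I, inner ℝ (u - w) (g t) ^ 2) / 4 := by
      rw [← Finset.sum_sub_distrib, Finset.sum_div]
      refine Finset.sum_congr rfl fun t _ => ?_
      rw [inner_add_left, inner_sub_left]; ring
    rw [hin, h1, norm_add_sq_real, norm_sub_sq_real]; ring
  have hc : (0 : ℝ) ≤ I.card := by positivity
  have hnet : ∀ u ∈ N, ∀ w ∈ N, |inner ℝ (y u) w| ≤ 1 / 8 * I.card := by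
    intro u hu w hw
    have h1 := abs_le.mp (h u hu w hw (u + w) (by simp))
    have h2 := abs_le.mp (h u hu w hw (u - w) (by simp))
    have h3 : ‖u + w‖ ^ 2 + ‖u - w‖ ^ 2 = 4 := by
      rw [norm_add_sq_real, norm_sub_sq_real, hN1 u hu, hN1 w hw]; ring
    have h4 : 1 / 8 * (I.card : ℝ) * ‖u + w‖ ^ 2 + 1 / 8 * I.card * ‖u - w‖ ^ 2 =
        1 / 2 * I.card := by rw [← mul_add, h3]; ring
    rw [hpol, abs_le]
    constructor <;> linarith [h1.1, h1.2, h2.1, h2.2]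
  have hyu : ∀ u ∈ N, ‖y u‖ ≤ 2 * (1 / 8 * I.card) := fun u hu =>
    norm_le_two_mul_of_half_net hN (by positivity) (hnet u hu)
  have hyv : ‖y v‖ ≤ 2 * (2 * (1 / 8 * I.card) * ‖v‖) := by
    refine norm_le_two_mul_of_half_net hN (by positivity) fun u hu => ?_
    rw [hsymm]
    refine (abs_real_inner_le_norm _ _).trans ?_
    gcongr
    exact hyu u hu
  have h1 := (abs_le.mp (abs_real_inner_le_norm (y v) v)).1
  have h2 : ‖y v‖ * ‖v‖ ≤ 2 * (2 * (1 / 8 * I.card) * ‖v‖) * ‖v‖ := by gcongr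
  rw [hin, real_inner_self_eq_norm_sq] at h1
  have h3 : ∑ t ∈ I, inner ℝ v (g t) * inner ℝ v (g t) = ∑ t ∈ I, inner ℝ v (g t) ^ 2 :=
    Finset.sum_congr rfl fun _ _ => (sq _).symm
  rw [h3] at h1
  nlinarith

end

/-! ### Chi-square concentration and the noise covariance -/

theorem integral_exp_mul_sq_gaussianReal {l : ℝ} (hl : l < 1 / 2) :
    Integrable (fun x : ℝ => Real.exp (l * x ^ 2)) (gaussianReal 0 1) ∧
      ∫ x, Real.exp (l * x ^ 2) ∂(gaussianReal 0 1) = (Real.sqrt (1 - 2 * l))⁻¹ := by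
  have hb : 0 < 1 / 2 - l := by linarith
  have hpdf : ∀ x : ℝ, gaussianPDFReal 0 1 x • Real.exp (l * x ^ 2) =
      (Real.sqrt (2 * Real.pi))⁻¹ * Real.exp (-(1 / 2 - l) * x ^ 2) := by
    intro x
    rw [gaussianPDFReal_def, smul_eq_mul, mul_assoc, ← Real.exp_add]
    simp only [NNReal.coe_one, mul_one, sub_zero]
    congr 2
    ring
  constructor
  · rw [gaussianReal_of_var_ne_zero _ one_ne_zero,
      integrable_withDensity_iff_integrable_smul' (measurable_gaussianPDF 0 1)
        (ae_of_all _ fun _ => gaussianPDF_lt_top)]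
    simp only [toReal_gaussianPDF, hpdf]
    exact (integrable_exp_neg_mul_sq hb).const_mul _
  · rw [integral_gaussianReal_eq_integral_smul one_ne_zero]
    simp only [hpdf]
    rw [integral_const_mul, integral_gaussian, ← Real.sqrt_inv, ← Real.sqrt_mul (by positivity),
      ← Real.sqrt_inv]
    congr 1
    have := Real.pi_pos.ne'
    have h1 : 1 - 2 * l ≠ 0 := by linarith
    field_simp

/-- The integral is `exp (-l - ½ log (1 - 2l))`, and `log (1 - 2l) ≥ -2l - 4l²` in this range. -/
theorem mgf_sq_sub_one_gaussianReal_le {l : ℝ} (hl : |l| ≤ 1 / 8) :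
    ∫ x, Real.exp (l * (x ^ 2 - 1)) ∂(gaussianReal 0 1) ≤ Real.exp (2 * l ^ 2) := by
  obtain ⟨h1, h2⟩ := abs_le.mp hl
  have hpos : 0 < 1 - 2 * l := by linarith
  have e : ∀ x : ℝ, Real.exp (l * (x ^ 2 - 1)) = Real.exp (-l) * Real.exp (l * x ^ 2) := by
    intro x; rw [← Real.exp_add]; ring_nf
  simp only [e]
  rw [integral_const_mul, (integral_exp_mul_sq_gaussianReal (by linarith)).2,
    Real.sqrt_eq_rpow, ← Real.rpow_neg hpos.le, Real.rpow_def_of_pos hpos, ← Real.exp_add]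
  apply Real.exp_le_exp.mpr
  have h3 : -(2 * l) - 4 * l ^ 2 ≤ Real.log (1 - 2 * l) := by
    have := Real.abs_log_sub_add_sum_range_le (x := 2 * l)
      (by rw [abs_lt]; constructor <;> linarith) 2
    simp only [Finset.sum_range_succ, Finset.sum_range_zero, zero_add, pow_one, Nat.cast_zero,
      div_one, Nat.cast_one, one_add_one_eq_two] at this
    have h4 := (abs_le.mp this).1
    have h6 : |2 * l| ≤ 1 / 4 := by rw [abs_mul]; norm_num; linarith
    have h5 : |2 * l| ^ (2 + 1) / (1 - |2 * l|) ≤ 2 * l ^ 2 := by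
      rw [div_le_iff₀ (by linarith), pow_succ, sq_abs]
      nlinarith [sq_nonneg l]
    linarith
  linarith

/-- Independent standard Gaussian vectors. -/
structure IsStdNoise {E : Type*} [NormedAddCommGroup E] [InnerProductSpace ℝ E]
    [MeasurableSpace E] {Ω : Type*} [MeasurableSpace Ω] (P : Measure Ω) (g : ℕ → Ω → E) :
    Prop where
  measurable : ∀ t, Measurable (g t)
  indep : iIndepFun g P
  map_inner : ∀ t (u : E), P.map (fun ω => inner ℝ u (g t ω)) = gaussianReal 0 (‖u‖₊ ^ 2)

section
variable {E : Type*} [NormedAddCommGroup E] [InnerProductSpace ℝ E] [FiniteDimensional ℝ E]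
  [MeasurableSpace E] [BorelSpace E] {Ω : Type*} [MeasurableSpace Ω] {P : Measure Ω}
  {g : ℕ → Ω → E}

theorem IsStdNoise.measurable_inner (hg : IsStdNoise P g) (t : ℕ) (u : E) :
    Measurable fun ω => inner ℝ u (g t ω) := by
  have := hg.measurable t
  fun_prop

variable [IsProbabilityMeasure P]

theorem IsStdNoise.mgf_sum_sq_le (hg : IsStdNoise P g) {u : E} (hu : ‖u‖ = 1) {l : ℝ}
    (hl : |l| ≤ 1 / 8) (I : Finset ℕ) :
    Integrable (fun ω => Real.exp (l * ∑ t ∈ I, (inner ℝ u (g t ω) ^ 2 - 1))) P ∧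
    mgf (fun ω => ∑ t ∈ I, (inner ℝ u (g t ω) ^ 2 - 1)) P l ≤ Real.exp (I.card * (2 * l ^ 2)) := by
  have hl2 : l < 1 / 2 := by linarith [(abs_le.mp hl).2]
  set X : ℕ → Ω → ℝ := fun t ω => inner ℝ u (g t ω) ^ 2 - 1 with hX
  have hmap : ∀ t, P.map (fun ω => inner ℝ u (g t ω)) = gaussianReal 0 1 := fun t => by
    rw [hg.map_inner t u]; congr 1
    ext; simp [hu]
  have hind : iIndepFun X P := hg.indep.comp (fun _ x => inner ℝ u x ^ 2 - 1)
    (fun _ => by fun_prop)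
  have hmeas : ∀ t, Measurable (X t) := fun t => ((hg.measurable_inner t u).pow_const 2).sub_const 1
  have hsum : (fun ω => ∑ t ∈ I, (inner ℝ u (g t ω) ^ 2 - 1)) = ∑ t ∈ I, X t := by
    ext ω; simp [hX]
  have hint : ∀ t, Integrable (fun ω => Real.exp (l * X t ω)) P := by
    intro t
    have h1 : Integrable (fun x : ℝ => Real.exp (l * (x ^ 2 - 1))) (gaussianReal 0 1) := by
      have := (integral_exp_mul_sq_gaussianReal hl2).1.const_mul (Real.exp (-l))
      refine this.congr (ae_of_all _ fun x => ?_)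
      simp only
      rw [← Real.exp_add]; ring_nf
    rw [← hmap t] at h1
    exact (integrable_map_measure (by fun_prop) (hg.measurable_inner t u).aemeasurable).mp h1
  constructor
  · have := hind.integrable_exp_mul_sum hmeas (s := I) fun i _ => hint i
    rwa [← hsum] at this
  · rw [hsum, hind.mgf_sum hmeas, Real.exp_nat_mul, ← Finset.prod_const]
    refine Finset.prod_le_prod (fun _ _ => mgf_nonneg) fun t _ => ?_
    refine le_trans (le_of_eq ?_) (mgf_sq_sub_one_gaussianReal_le hl)
    rw [← hmap t, integral_map (hg.measurable_inner t u).aemeasurable (by fun_prop)]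
    rfl

theorem IsStdNoise.measure_abs_sum_sq_gt_le (hg : IsStdNoise P g) (x : E) (I : Finset ℕ) :
    P.real {ω | 1 / 8 * I.card * ‖x‖ ^ 2 <
      |∑ t ∈ I, inner ℝ x (g t ω) ^ 2 - I.card * ‖x‖ ^ 2|} ≤ 2 * Real.exp (-(I.card / 512)) := by
  rcases eq_or_ne x 0 with rfl | hx
  · simp; positivity
  have hx' : 0 < ‖x‖ := norm_pos_iff.mpr hx
  set u := ‖x‖⁻¹ • x
  have hu : ‖u‖ = 1 := by rw [norm_smul, norm_inv, norm_norm, inv_mul_cancel₀ hx'.ne']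
  have hxu : x = ‖x‖ • u := by rw [smul_smul, mul_inv_cancel₀ hx'.ne', one_smul]
  have hset : {ω | 1 / 8 * I.card * ‖x‖ ^ 2 <
      |∑ t ∈ I, inner ℝ x (g t ω) ^ 2 - I.card * ‖x‖ ^ 2|} ⊆
      {ω | 1 / 8 * (I.card : ℝ) ≤ ∑ t ∈ I, (inner ℝ u (g t ω) ^ 2 - 1)} ∪
      {ω | ∑ t ∈ I, (inner ℝ u (g t ω) ^ 2 - 1) ≤ -(1 / 8 * (I.card : ℝ))} := by
    intro ω hω
    simp only [Set.mem_ofPred_eq, Set.mem_union] at hω ⊢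
    have e : ∑ t ∈ I, inner ℝ x (g t ω) ^ 2 - I.card * ‖x‖ ^ 2 =
        ‖x‖ ^ 2 * ∑ t ∈ I, (inner ℝ u (g t ω) ^ 2 - 1) := by
      rw [Finset.sum_sub_distrib, mul_sub, Finset.mul_sum]
      congr 1
      · refine Finset.sum_congr rfl fun t _ => ?_
        conv_lhs => rw [hxu, real_inner_smul_left]
        ring
      · simp; ring
    rw [e, abs_mul, abs_of_pos (by positivity), mul_comm, mul_lt_mul_iff_right₀ (by positivity),
      lt_abs] at hω
    rcases hω with h | h
    · exact Or.inl h.le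
    · right; linarith
  refine (measureReal_mono hset).trans ((measureReal_union_le _ _).trans ?_)
  -- `l = 1/32` minimizes the Chernoff exponent `-l/8 + 2l²`, with value `-1/512`.
  obtain ⟨i1, m1⟩ := hg.mgf_sum_sq_le hu (l := 1 / 32) (by rw [abs_of_pos] <;> norm_num) I
  obtain ⟨i2, m2⟩ := hg.mgf_sum_sq_le hu (l := -(1 / 32)) (by rw [abs_neg, abs_of_pos] <;> norm_num) I
  have h1 := measure_ge_le_exp_mul_mgf (1 / 8 * (I.card : ℝ)) (by norm_num) i1
  have h2 := measure_le_le_exp_mul_mgf (-(1 / 8 * (I.card : ℝ))) (by norm_num) i2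
  have e1 : Real.exp (-(I.card / 512 : ℝ)) = Real.exp (-(1 / 32) * (1 / 8 * (I.card : ℝ))) *
      Real.exp (I.card * (2 * (1 / 32) ^ 2)) := by rw [← Real.exp_add]; ring_nf
  have e2 : Real.exp (-(I.card / 512 : ℝ)) = Real.exp (-(-(1 / 32)) * (-(1 / 8 * (I.card : ℝ)))) *
      Real.exp (I.card * (2 * (-(1 / 32)) ^ 2)) := by rw [← Real.exp_add]; ring_nf
  have h3 := h1.trans (mul_le_mul_of_nonneg_left m1 (Real.exp_nonneg _))
  have h4 := h2.trans (mul_le_mul_of_nonneg_left m2 (Real.exp_nonneg _))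
  rw [← e1] at h3
  rw [← e2] at h4
  linarith

theorem IsStdNoise.measure_not_sum_sq_ge_le (hg : IsStdNoise P g) (I : Finset ℕ) :
    P.real {ω | ¬ ∀ v : E, 1 / 2 * I.card * ‖v‖ ^ 2 ≤ ∑ t ∈ I, inner ℝ v (g t ω) ^ 2} ≤
      4 * 25 ^ Module.finrank ℝ E * Real.exp (-(I.card / 512)) := by
  obtain ⟨N, hcard, hN1, hN⟩ := exists_half_net_sphere E
  set bad : E → Set Ω := fun x => {ω | 1 / 8 * I.card * ‖x‖ ^ 2 <
      |∑ t ∈ I, inner ℝ x (g t ω) ^ 2 - I.card * ‖x‖ ^ 2|} with hbad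
  have hsub : {ω | ¬ ∀ v : E, 1 / 2 * I.card * ‖v‖ ^ 2 ≤ ∑ t ∈ I, inner ℝ v (g t ω) ^ 2} ⊆
      ⋃ p ∈ N ×ˢ N, (bad (p.1 + p.2) ∪ bad (p.1 - p.2)) := by
    intro ω hω
    by_contra hcon
    apply hω
    refine sum_inner_sq_ge_of_half_net hN1 hN I (fun t => g t ω) ?_
    intro u hu w hw x hx
    simp only [Set.mem_iUnion, not_exists, hbad, Set.mem_union, Set.mem_ofPred_eq, not_or,
      not_lt] at hcon
    have := hcon (u, w) (Finset.mem_product.mpr ⟨hu, hw⟩)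
    rcases hx with rfl | rfl
    exacts [this.1, this.2]
  refine (measureReal_mono hsub (measure_ne_top _ _)).trans ((measureReal_biUnion_finset_le _ _).trans ?_)
  have h1 : ∀ p ∈ N ×ˢ N, P.real (bad (p.1 + p.2) ∪ bad (p.1 - p.2)) ≤
      4 * Real.exp (-(I.card / 512)) := by
    intro p _
    refine (measureReal_union_le _ _).trans ?_
    linarith [hg.measure_abs_sum_sq_gt_le (p.1 + p.2) I, hg.measure_abs_sum_sq_gt_le (p.1 - p.2) I]
  refine (Finset.sum_le_card_nsmul _ _ _ h1).trans ?_
  rw [Finset.card_product, nsmul_eq_mul]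
  have h2 : ((N.card * N.card : ℕ) : ℝ) ≤ 25 ^ Module.finrank ℝ E := by
    have : N.card * N.card ≤ 5 ^ Module.finrank ℝ E * 5 ^ Module.finrank ℝ E := by gcongr
    rw [← mul_pow] at this
    exact_mod_cast this
  calc _ ≤ (25 : ℝ) ^ Module.finrank ℝ E * (4 * Real.exp (-(I.card / 512))) := by gcongr
    _ = _ := by ring

end

/-! ### Gaussian integrals of quadratic forms -/

open scoped Matrix

/-- The regularized empirical covariance matrix `κ I + ∑ z_t z_tᵀ`. -/
noncomputable def regCov {d : ℕ} {ι : Type*} (I : Finset ι) (z : ι → EuclideanSpace ℝ (Fin d)) (κ : ℝ) :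
    Matrix (Fin d) (Fin d) ℝ :=
  κ • 1 + ∑ t ∈ I, Matrix.vecMulVec (z t).ofLp (z t).ofLp

theorem dotProduct_regCov_mulVec {d : ℕ} {ι : Type*} (I : Finset ι)
    (z : ι → EuclideanSpace ℝ (Fin d)) (κ : ℝ) (y : EuclideanSpace ℝ (Fin d)) :
    y.ofLp ⬝ᵥ (regCov I z κ *ᵥ y.ofLp) = ∑ t ∈ I, inner ℝ y (z t) ^ 2 + κ * ‖y‖ ^ 2 := by
  rw [regCov, Matrix.add_mulVec, dotProduct_add, add_comm, Matrix.smul_mulVec, Matrix.one_mulVec,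
    dotProduct_smul, Matrix.sum_mulVec, dotProduct_sum]
  congr 1
  · refine Finset.sum_congr rfl fun t _ => ?_
    rw [Matrix.vecMulVec_mulVec, EuclideanSpace.inner_eq_star_dotProduct]
    simp [sq, dotProduct_comm]
  · rw [EuclideanSpace.real_norm_sq_eq]
    simp [dotProduct, sq]

theorem posSemidef_regCov {d : ℕ} {ι : Type*} (I : Finset ι)
    (z : ι → EuclideanSpace ℝ (Fin d)) {κ : ℝ} (hκ : 0 ≤ κ) : (regCov I z κ).PosSemidef :=
  (Matrix.PosSemidef.one.smul hκ).add
    (Matrix.posSemidef_sum _ fun t _ => by simpa using Matrix.posSemidef_vecMulVec_self_star (z t).ofLp)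

theorem posDef_regCov {d : ℕ} {ι : Type*} (I : Finset ι)
    (z : ι → EuclideanSpace ℝ (Fin d)) {κ : ℝ} (hκ : 0 < κ) : (regCov I z κ).PosDef :=
  (Matrix.PosDef.one.smul hκ).add_posSemidef
    (Matrix.posSemidef_sum _ fun t _ => by simpa using Matrix.posSemidef_vecMulVec_self_star (z t).ofLp)

/-- The integral of the unnormalized standard Gaussian density. -/
noncomputable def gaussianMass (d : ℕ) : ENNReal :=
  ∫⁻ y : EuclideanSpace ℝ (Fin d), ENNReal.ofReal (Real.exp (-(1 / 2) * ‖y‖ ^ 2))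

theorem gaussianMass_eq (d : ℕ) : gaussianMass d = ENNReal.ofReal
    (∫ y : EuclideanSpace ℝ (Fin d), Real.exp (-(1 / 2) * ‖y‖ ^ 2)) ∧
    0 < ∫ y : EuclideanSpace ℝ (Fin d), Real.exp (-(1 / 2) * ‖y‖ ^ 2) := by
  have h := GaussianFourier.integral_rexp_neg_mul_sq_norm (V := EuclideanSpace ℝ (Fin d))
    (b := 1 / 2) (by norm_num)
  have hpos : 0 < ∫ y : EuclideanSpace ℝ (Fin d), Real.exp (-(1 / 2) * ‖y‖ ^ 2) := by
    rw [h]; positivity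
  refine ⟨?_, hpos⟩
  rw [gaussianMass, ofReal_integral_eq_lintegral_ofReal]
  · by_contra hi
    rw [integral_undef hi] at hpos
    exact lt_irrefl _ hpos
  · exact ae_of_all _ fun _ => (Real.exp_pos _).le

theorem gaussianMass_pos (d : ℕ) : gaussianMass d ≠ 0 := by
  rw [(gaussianMass_eq d).1]
  simpa using (gaussianMass_eq d).2

theorem gaussianMass_ne_top (d : ℕ) : gaussianMass d ≠ ⊤ := by
  rw [(gaussianMass_eq d).1]; exact ENNReal.ofReal_ne_top

/-- Substitute `R y` with `P = Rᴴ R`. The factor `gaussianMass d` is left unevaluated because it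
cancels later. -/
theorem lintegral_exp_neg_quadratic {d : ℕ} {P : Matrix (Fin d) (Fin d) ℝ} (hP : P.PosDef) :
    ∫⁻ y : EuclideanSpace ℝ (Fin d),
      ENNReal.ofReal (Real.exp (-(1 / 2) * (y.ofLp ⬝ᵥ (P *ᵥ y.ofLp)))) =
    ENNReal.ofReal (Real.sqrt P.det)⁻¹ * gaussianMass d := by
  obtain ⟨R, hR⟩ := hP.posSemidef.exists_eq_conjTranspose_mul_self
  have hdet : P.det = R.det ^ 2 := by
    rw [hR, Matrix.det_mul, Matrix.det_conjTranspose]; simp [sq]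
  have hPd := hP.det_pos
  have hRd : R.det ≠ 0 := by
    intro h; rw [hdet, h] at hPd; simp at hPd
  set f := Matrix.toLpLin 2 2 R with hf
  have hfdet : LinearMap.det f = R.det := by
    rw [hf, Matrix.toLpLin_eq_toLin, LinearMap.det_toLin]
  have hq : ∀ y : EuclideanSpace ℝ (Fin d), y.ofLp ⬝ᵥ (P *ᵥ y.ofLp) = ‖f y‖ ^ 2 := by
    intro y
    rw [hR, ← Matrix.mulVec_mulVec, Matrix.dotProduct_mulVec, EuclideanSpace.real_norm_sq_eq]
    simp [hf, Matrix.toLpLin_apply, dotProduct, sq, Matrix.vecMul_transpose]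
  have hmap := Measure.map_linearMap_addHaar_eq_smul_addHaar
    (volume : Measure (EuclideanSpace ℝ (Fin d))) (f := f) (by rw [hfdet]; exact hRd)
  have hfm : Measurable f := (LinearMap.continuous_of_finiteDimensional f).measurable
  simp only [hq]
  rw [← lintegral_map (f := fun y : EuclideanSpace ℝ (Fin d) =>
    ENNReal.ofReal (Real.exp (-(1 / 2) * ‖y‖ ^ 2))) (by fun_prop) hfm, hmap,
    lintegral_smul_measure, gaussianMass, hfdet, hdet, Real.sqrt_sq_eq_abs, abs_inv, smul_eq_mul]

/-- Vectors which normalize a positive definite matrix `Γ` and bound determinants relative to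
that of `Γ` by traces. -/
theorem Matrix.PosDef.exists_normalizing_vectors {d : ℕ} (hd : 1 ≤ d)
    {Γ : Matrix (Fin d) (Fin d) ℝ} (hΓ : Γ.PosDef) :
    ∃ w : Fin d → EuclideanSpace ℝ (Fin d), (∀ i, (w i).ofLp ⬝ᵥ (Γ *ᵥ (w i).ofLp) = 1) ∧
      ∀ (P : Matrix (Fin d) (Fin d) ℝ) (c : ℝ), P.PosSemidef →
        ∑ i, (w i).ofLp ⬝ᵥ (P *ᵥ (w i).ofLp) ≤ d * c → P.det ≤ Γ.det * c ^ d := by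
  have : Nonempty (Fin d) := ⟨⟨0, hd⟩⟩
  obtain ⟨R, hR⟩ := hΓ.posSemidef.exists_eq_conjTranspose_mul_self
  have hdet : Γ.det = R.det ^ 2 := by
    rw [hR, Matrix.det_mul, Matrix.det_conjTranspose]; simp [sq]
  have hΓd := hΓ.det_pos
  have hRd : R.det ≠ 0 := by
    intro h; rw [hdet, h] at hΓd; simp at hΓd
  have hRu : IsUnit R.det := hRd.isUnit
  -- The vectors are the columns of `W`: with `Γ = Rᴴ R` one has `Wᴴ Γ W = 1`, and AM–GM is applied
  -- to `Wᴴ P W`.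
  set W := R⁻¹ with hW
  have hRW : R * W = 1 := Matrix.mul_nonsing_inv _ hRu
  have hentry : ∀ (P : Matrix (Fin d) (Fin d) ℝ) (i : Fin d),
      (W.col i) ⬝ᵥ (P *ᵥ (W.col i)) = (Wᴴ * P * W) i i := by
    intro P i
    rw [Matrix.mul_assoc, Matrix.mul_apply]
    simp [dotProduct, Matrix.mul_apply, Matrix.mulVec, Matrix.col_apply]
  refine ⟨fun i => WithLp.toLp 2 (W.col i), fun i => ?_, fun P c hP hc => ?_⟩
  · rw [hentry, hR, show Wᴴ * (Rᴴ * R) * W = (R * W)ᴴ * (R * W) by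
      simp only [Matrix.conjTranspose_mul, Matrix.mul_assoc], hRW]
    simp
  · simp only [hentry] at hc
    have h1 := (hP.conjTranspose_mul_mul_same W).re_det_le_pow (B := c)
      (by simpa [Matrix.trace] using hc)
    have h2 : R.det * W.det = 1 := by rw [← Matrix.det_mul, hRW, Matrix.det_one]
    rw [Matrix.det_mul, Matrix.det_mul, Matrix.det_conjTranspose, Fintype.card_fin] at h1
    simp only [RCLike.re_to_real, star_trivial] at h1
    calc P.det = R.det ^ 2 * (W.det * P.det * W.det) := by
          linear_combination (-(P.det) * (R.det * W.det + 1)) * h2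
      _ ≤ R.det ^ 2 * c ^ d := by gcongr
      _ = _ := by rw [hdet]

/-- Translate the integral to `x` and average over `y` and `-y`: the terms linear in `y` combine to
a hyperbolic cosine, which is at least `1`. No completion of the square is needed, and `x` stays
arbitrary. -/
theorem lintegral_exp_linear_sub_quadratic_ge {d : ℕ} (P : Matrix (Fin d) (Fin d) ℝ)
    (hP : P.PosSemidef) (s x : EuclideanSpace ℝ (Fin d)) :
    ENNReal.ofReal (Real.exp (inner ℝ x s - 1 / 2 * (x.ofLp ⬝ᵥ (P *ᵥ x.ofLp)))) *
      ∫⁻ y : EuclideanSpace ℝ (Fin d),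
        ENNReal.ofReal (Real.exp (-(1 / 2) * (y.ofLp ⬝ᵥ (P *ᵥ y.ofLp)))) ≤
    ∫⁻ y : EuclideanSpace ℝ (Fin d),
      ENNReal.ofReal (Real.exp (inner ℝ y s - 1 / 2 * (y.ofLp ⬝ᵥ (P *ᵥ y.ofLp)))) := by
  set Q : EuclideanSpace ℝ (Fin d) → ℝ :=
    fun y => inner ℝ y s - 1 / 2 * (y.ofLp ⬝ᵥ (P *ᵥ y.ofLp)) with hQ
  set F : EuclideanSpace ℝ (Fin d) → ENNReal := fun y => ENNReal.ofReal (Real.exp (Q y)) with hF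
  have hQc : Continuous Q := by
    simp only [hQ, dotProduct, Matrix.mulVec]
    fun_prop
  have hFm : Measurable F := by
    have := hQc.measurable
    fun_prop
  have hexp : ∀ y, Real.exp (Q x) * Real.exp (-(1 / 2) * (y.ofLp ⬝ᵥ (P *ᵥ y.ofLp))) * 2 ≤
      Real.exp (Q (x + y)) + Real.exp (Q (x - y)) := by
    intro y
    have hs : y.ofLp ⬝ᵥ (P *ᵥ x.ofLp) = x.ofLp ⬝ᵥ (P *ᵥ y.ofLp) := by
      rw [Matrix.dotProduct_mulVec, ← Matrix.mulVec_transpose, dotProduct_comm,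
        show Pᵀ = P by simpa using hP.1.eq]
    set l := inner ℝ y s - x.ofLp ⬝ᵥ (P *ᵥ y.ofLp)
    have e1 : Q (x + y) = Q x - 1 / 2 * (y.ofLp ⬝ᵥ (P *ᵥ y.ofLp)) + l := by
      simp only [hQ, inner_add_left, WithLp.ofLp_add, Matrix.mulVec_add, dotProduct_add,
        add_dotProduct, hs, l]
      ring
    have e2 : Q (x - y) = Q x - 1 / 2 * (y.ofLp ⬝ᵥ (P *ᵥ y.ofLp)) + -l := by
      simp only [hQ, inner_sub_left, WithLp.ofLp_sub, Matrix.mulVec_sub, dotProduct_sub,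
        sub_dotProduct, hs, l]
      ring
    have h2 : 2 ≤ Real.exp l + Real.exp (-l) := by
      have := Real.one_le_cosh l
      rw [Real.cosh_eq] at this; linarith
    rw [e1, e2, Real.exp_add _ l, Real.exp_add _ (-l), ← mul_add, ← Real.exp_add]
    rw [show Q x + -(1 / 2) * (y.ofLp ⬝ᵥ (P *ᵥ y.ofLp)) =
      Q x - 1 / 2 * (y.ofLp ⬝ᵥ (P *ᵥ y.ofLp)) by ring]
    gcongr
  have h1 : ∫⁻ y, F (x + y) = ∫⁻ y, F y := lintegral_add_left_eq_self F x
  have h2 : ∫⁻ y, F (x - y) = ∫⁻ y, F y := lintegral_sub_left_eq_self F x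
  have h3 : (∫⁻ y : EuclideanSpace ℝ (Fin d), ENNReal.ofReal (Real.exp (Q x)) *
      ENNReal.ofReal (Real.exp (-(1 / 2) * (y.ofLp ⬝ᵥ (P *ᵥ y.ofLp))))) * 2 ≤
      (∫⁻ y, F y) * 2 := by
    calc _ = ∫⁻ y : EuclideanSpace ℝ (Fin d), ENNReal.ofReal (Real.exp (Q x)) *
        ENNReal.ofReal (Real.exp (-(1 / 2) * (y.ofLp ⬝ᵥ (P *ᵥ y.ofLp)))) * 2 :=
          (lintegral_mul_const' _ _ (by simp)).symm
      _ ≤ ∫⁻ y, (F (x + y) + F (x - y)) := by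
          refine lintegral_mono fun y => ?_
          simp only [hF]
          rw [← ENNReal.ofReal_add (Real.exp_nonneg _) (Real.exp_nonneg _)]
          have h5 := ENNReal.ofReal_le_ofReal (hexp y)
          rwa [ENNReal.ofReal_mul (by positivity), ENNReal.ofReal_mul (Real.exp_nonneg _),
            ENNReal.ofReal_ofNat] at h5
      _ = _ := by
          rw [lintegral_add_left (by fun_prop), h1, h2, mul_two]
  rw [lintegral_const_mul' _ _ ENNReal.ofReal_ne_top] at h3
  exact (ENNReal.mul_le_mul_iff_left (by simp) (by simp)).mp h3

/-- A bound on the Gaussian mixture of the exponentials `exp (⟪y, s⟫ - ½ ∑ ⟪y, z_t⟫²)` bounds `s`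
relative to the regularized empirical covariance. -/
theorem inner_sq_le_of_lintegral_le {d : ℕ} {ι : Type*} (I : Finset ι)
    (z : ι → EuclideanSpace ℝ (Fin d)) (s : EuclideanSpace ℝ (Fin d)) {κ b D : ℝ} (hκ : 0 < κ)
    (hb : 0 < b) (hD : (regCov I z κ).det ≤ D)
    (hF : ∫⁻ y : EuclideanSpace ℝ (Fin d), ENNReal.ofReal (Real.exp (inner ℝ y s -
      1 / 2 * ((∑ t ∈ I, inner ℝ y (z t) ^ 2) + κ * ‖y‖ ^ 2))) ≤
      ENNReal.ofReal b * (ENNReal.ofReal (Real.sqrt (κ ^ d))⁻¹ * gaussianMass d))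
    (w : EuclideanSpace ℝ (Fin d)) :
    inner ℝ w s ^ 2 ≤ 2 * (Real.log b + Real.log (D / κ ^ d) / 2) *
      (∑ t ∈ I, inner ℝ w (z t) ^ 2 + κ * ‖w‖ ^ 2) := by
  set P := regCov I z κ
  have hP : P.PosDef := posDef_regCov I z hκ
  have hPd := hP.det_pos
  simp only [← dotProduct_regCov_mulVec] at hF ⊢
  have hD0 : 0 < D := hPd.trans_le hD
  have key : ∀ x : EuclideanSpace ℝ (Fin d), inner ℝ x s - 1 / 2 * (x.ofLp ⬝ᵥ (P *ᵥ x.ofLp)) ≤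
      Real.log b + Real.log (D / κ ^ d) / 2 := by
    intro x
    have h1 := (lintegral_exp_linear_sub_quadratic_ge P hP.posSemidef s x).trans hF
    rw [lintegral_exp_neg_quadratic hP, ← mul_assoc, ← mul_assoc,
      ENNReal.mul_le_mul_iff_left (gaussianMass_pos d) (gaussianMass_ne_top d),
      ← ENNReal.ofReal_mul (Real.exp_nonneg _), ← ENNReal.ofReal_mul hb.le,
      ENNReal.ofReal_le_ofReal_iff (by positivity)] at h1
    have hs1 : 0 < Real.sqrt P.det := Real.sqrt_pos.mpr hPd
    have h2 : Real.exp (inner ℝ x s - 1 / 2 * (x.ofLp ⬝ᵥ (P *ᵥ x.ofLp))) ≤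
        b * Real.sqrt (D / κ ^ d) := by
      rw [mul_inv_le_iff₀ hs1] at h1
      refine h1.trans ?_
      rw [mul_assoc, Real.sqrt_div' _ (by positivity), div_eq_inv_mul]
      gcongr
    rw [← Real.log_exp (inner ℝ x s - _)]
    refine (Real.log_le_log (Real.exp_pos _) h2).trans (le_of_eq ?_)
    rw [Real.log_mul hb.ne' (by positivity), Real.log_sqrt (by positivity)]
  rcases eq_or_ne w 0 with rfl | hw
  · simp
  have hq : 0 < w.ofLp ⬝ᵥ (P *ᵥ w.ofLp) := by
    rw [dotProduct_regCov_mulVec]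
    have := norm_pos_iff.mpr hw
    have : 0 ≤ ∑ t ∈ I, inner ℝ w (z t) ^ 2 := Finset.sum_nonneg fun _ _ => sq_nonneg _
    positivity
  set q := w.ofLp ⬝ᵥ (P *ᵥ w.ofLp) with hqdef
  -- This multiple of `w` maximizes the linear minus the quadratic term along the line through `w`.
  have h := key ((inner ℝ w s / q) • w)
  rw [real_inner_smul_left, WithLp.ofLp_smul, Matrix.mulVec_smul, smul_dotProduct, dotProduct_smul,
    ← hqdef, smul_eq_mul, smul_eq_mul] at h
  have h2 : inner ℝ w s / q * inner ℝ w s - 1 / 2 * (inner ℝ w s / q * (inner ℝ w s / q * q)) =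
      inner ℝ w s ^ 2 / q / 2 := by field_simp; ring
  rw [h2, div_le_iff₀ (by norm_num), div_le_iff₀ hq] at h
  linarith

/-! ### The exponential martingale and the self-normalized bound -/

/-- The joint law is a product, so the fresh variable can be integrated out with the past frozen;
this takes the place of conditional expectations. -/
theorem lintegral_comp_of_indep {Ω β γ : Type*} {m mΩ : MeasurableSpace Ω} [MeasurableSpace β]
    [mγ : MeasurableSpace γ] {P : Measure Ω} [IsProbabilityMeasure P] (hm : m ≤ mΩ) {Y : Ω → β}
    (hY : Measurable[m] Y) {n : Ω → γ} (hn : Measurable n) (h : Indep m (mγ.comap n) P)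
    {f : β → γ → ENNReal} (hf : Measurable (Function.uncurry f)) :
    ∫⁻ ω, f (Y ω) (n ω) ∂P = ∫⁻ ω, ∫⁻ x, f (Y ω) x ∂(P.map n) ∂P := by
  have hY' : Measurable Y := hY.mono hm le_rfl
  have hind : IndepFun Y n P := by
    rw [IndepFun_iff_Indep]
    exact indep_of_indep_of_le_left h hY.comap_le
  have hmap := (indepFun_iff_map_prod_eq_prod_map_map hY'.aemeasurable hn.aemeasurable).mp hind
  have hnp : IsProbabilityMeasure (P.map n) := Measure.isProbabilityMeasure_map hn.aemeasurable
  calc ∫⁻ ω, f (Y ω) (n ω) ∂P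
      = ∫⁻ p, Function.uncurry f p ∂(P.map fun ω => (Y ω, n ω)) :=
        (lintegral_map hf (hY'.prodMk hn)).symm
    _ = ∫⁻ y, ∫⁻ x, f y x ∂(P.map n) ∂(P.map Y) := by
        rw [hmap, lintegral_prod _ hf.aemeasurable]; rfl
    _ = _ := lintegral_map hf.lintegral_prod_right' hY'

theorem lintegral_exp_mul_sub_gaussianReal (y : ℝ) :
    ∫⁻ x, ENNReal.ofReal (Real.exp (y * x - 1 / 2 * y ^ 2)) ∂(gaussianReal 0 1) = 1 := by
  have e : ∀ x : ℝ, Real.exp (y * x - 1 / 2 * y ^ 2) =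
      Real.exp (-(1 / 2 * y ^ 2)) * Real.exp (y * x) := by
    intro x; rw [← Real.exp_add]; ring_nf
  simp only [e]
  rw [← ofReal_integral_eq_lintegral_ofReal
    ((integrable_exp_mul_gaussianReal y).const_mul _) (ae_of_all _ fun _ => by positivity),
    integral_const_mul]
  have h := congrFun (mgf_fun_id_gaussianReal (μ := 0) (v := 1)) y
  rw [mgf] at h
  rw [h, ← Real.exp_add]
  simp
  ring

theorem lintegral_add_sq_gaussianReal (a : ℝ) (v : NNReal) :
    ∫⁻ x, ENNReal.ofReal ((a + x) ^ 2) ∂(gaussianReal 0 v) = ENNReal.ofReal (a ^ 2 + v) := by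
  have h2 : MemLp (fun x : ℝ => x) 2 (gaussianReal 0 v) := memLp_id_gaussianReal 2
  have i1 : Integrable (fun x : ℝ => x) (gaussianReal 0 v) := h2.integrable (by norm_num)
  have i2 : Integrable (fun x : ℝ => x ^ 2) (gaussianReal 0 v) := h2.integrable_sq
  have e : ∀ x : ℝ, (a + x) ^ 2 = a ^ 2 + (2 * a) * x + x ^ 2 := fun x => by ring
  have hvar : ∫ x, x ^ 2 ∂(gaussianReal 0 v) = v := by
    have h3 := variance_eq_sub (μ := gaussianReal 0 v) h2
    rw [variance_fun_id_gaussianReal] at h3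
    simp only [Pi.pow_apply, integral_id_gaussianReal] at h3
    linarith
  have ii : Integrable (fun x : ℝ => a ^ 2 + (2 * a) * x) (gaussianReal 0 v) :=
    (integrable_const _).add (i1.const_mul _)
  rw [← ofReal_integral_eq_lintegral_ofReal _ (ae_of_all _ fun _ => sq_nonneg _)]
  · simp only [e]
    rw [integral_add ii i2, integral_add (integrable_const _) (i1.const_mul _),
      integral_const_mul, hvar]
    simp
  · simp only [e]; exact ii.add i2

section
variable {d : ℕ} {Ω : Type*} {mΩ : MeasurableSpace Ω} {P : Measure Ω}
  {g : ℕ → Ω → EuclideanSpace ℝ (Fin d)}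

/-- A process `Z` is nonanticipating for the noise `g`: relative to some increasing family of
σ-algebras, `Z t` is known at time `t`, when `g t` is still independent of the past. -/
structure IsNonanticipating (P : Measure Ω) (Z g : ℕ → Ω → EuclideanSpace ℝ (Fin d)) :
    Prop where
  exists_filtration : ∃ m : ℕ → MeasurableSpace Ω, (∀ t, m t ≤ mΩ) ∧ Monotone m ∧
    (∀ t, Measurable[m t] (Z t)) ∧ (∀ t, Measurable[m (t + 1)] (g t)) ∧
    ∀ t, Indep (m t) (MeasurableSpace.comap (g t) inferInstance) P

theorem IsStdNoise.map_inner_unit (hg : IsStdNoise P g) (t : ℕ) {u : EuclideanSpace ℝ (Fin d)}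
    (hu : ‖u‖ = 1) : P.map (fun ω => inner ℝ u (g t ω)) = gaussianReal 0 1 := by
  rw [hg.map_inner t u]; congr 1; ext; simp [hu]

theorem IsNonanticipating.measurable {Z : ℕ → Ω → EuclideanSpace ℝ (Fin d)}
    (hZ : IsNonanticipating P Z g) (t : ℕ) : Measurable (Z t) := by
  obtain ⟨m, hm, -, hZm, -⟩ := hZ.exists_filtration
  exact (hZm t).mono (hm t) le_rfl

/-- Given the past, `⟪u, g_T⟫` is standard Gaussian and `⟪y, Z_T⟫` is a constant, so the last factor
integrates to one. -/
theorem IsStdNoise.lintegral_exp_sum_eq_one [IsProbabilityMeasure P] (hg : IsStdNoise P g)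
    {Z : ℕ → Ω → EuclideanSpace ℝ (Fin d)} (hZ : IsNonanticipating P Z g)
    {u : EuclideanSpace ℝ (Fin d)} (hu : ‖u‖ = 1) (y : EuclideanSpace ℝ (Fin d)) (T : ℕ) :
    ∫⁻ ω, ENNReal.ofReal (Real.exp (∑ t ∈ Finset.range T,
      (inner ℝ y (Z t ω) * inner ℝ u (g t ω) - 1 / 2 * inner ℝ y (Z t ω) ^ 2))) ∂P = 1 := by
  obtain ⟨m, hm, hmono, hZm, hgm, hind⟩ := hZ.exists_filtration
  induction T with
  | zero => simp
  | succ T ih =>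
    set S : Ω → ℝ := fun ω => ∑ t ∈ Finset.range T,
      (inner ℝ y (Z t ω) * inner ℝ u (g t ω) - 1 / 2 * inner ℝ y (Z t ω) ^ 2) with hS
    have hSm : Measurable[m T] S := by
      refine Finset.measurable_sum _ fun t ht => ?_
      have ht' := Finset.mem_range.mp ht
      have h1 : Measurable[m T] (Z t) := (hZm t).mono (hmono ht'.le) le_rfl
      have h2 : Measurable[m T] (g t) := (hgm t).mono (hmono ht') le_rfl
      fun_prop
    have hYm : Measurable[m T] fun ω => (S ω, inner ℝ y (Z T ω)) := by
      have := hZm T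
      refine Measurable.prodMk hSm ?_
      fun_prop
    have hn : Measurable fun ω => inner ℝ u (g T ω) := hg.measurable_inner T u
    have hind' : Indep (m T) (MeasurableSpace.comap (fun ω => inner ℝ u (g T ω)) inferInstance) P := by
      refine indep_of_indep_of_le_right (hind T) ?_
      have hin : Measurable fun x : EuclideanSpace ℝ (Fin d) => (inner ℝ u x : ℝ) := by fun_prop
      have : (fun ω => (inner ℝ u (g T ω) : ℝ)) = (fun x => inner ℝ u x) ∘ g T := rfl
      rw [this, ← MeasurableSpace.comap_comp]
      exact MeasurableSpace.comap_mono hin.comap_le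
    have hkey := lintegral_comp_of_indep (hm T) hYm hn hind'
      (f := fun p x => ENNReal.ofReal (Real.exp p.1) *
        ENNReal.ofReal (Real.exp (p.2 * x - 1 / 2 * p.2 ^ 2))) (by
          simp only [Function.uncurry_def]; fun_prop)
    rw [hg.map_inner_unit T hu] at hkey
    calc _ = ∫⁻ ω, ENNReal.ofReal (Real.exp (S ω)) * ENNReal.ofReal (Real.exp
          (inner ℝ y (Z T ω) * inner ℝ u (g T ω) - 1 / 2 * inner ℝ y (Z T ω) ^ 2)) ∂P := by
          refine lintegral_congr fun ω => ?_
          rw [Finset.sum_range_succ, Real.exp_add, ENNReal.ofReal_mul (Real.exp_nonneg _)]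
      _ = _ := hkey
      _ = ∫⁻ ω, ENNReal.ofReal (Real.exp (S ω)) ∂P := by
          refine lintegral_congr fun ω => ?_
          rw [lintegral_const_mul' _ _ ENNReal.ofReal_ne_top, lintegral_exp_mul_sub_gaussianReal,
            mul_one]
      _ = 1 := ih

end

section
variable {d : ℕ} {Ω : Type*} {mΩ : MeasurableSpace Ω} {P : Measure Ω}
  {g : ℕ → Ω → EuclideanSpace ℝ (Fin d)}

theorem measure_lt_le_of_lintegral_le {f : Ω → ENNReal} (hf : AEMeasurable f P) {a ε : ℝ}
    {M : ENNReal} (hM0 : M ≠ 0) (hM : M ≠ ⊤) (ha : 0 < a) (hε : 1 / a ≤ ε)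
    (h : ∫⁻ ω, f ω ∂P ≤ M) :
    P {ω | ENNReal.ofReal a * M < f ω} ≤ ENNReal.ofReal ε := by
  have ha' : ENNReal.ofReal a ≠ 0 := by simpa using ha
  have hc : ENNReal.ofReal a * M ≠ 0 := mul_ne_zero ha' hM0
  have hc' : ENNReal.ofReal a * M ≠ ⊤ := ENNReal.mul_ne_top ENNReal.ofReal_ne_top hM
  calc P {ω | ENNReal.ofReal a * M < f ω} ≤ P {ω | ENNReal.ofReal a * M ≤ f ω} :=
        measure_mono fun ω hω => by
          simp only [Set.mem_ofPred_eq] at hω ⊢; exact hω.le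
    _ ≤ (∫⁻ ω, f ω ∂P) / (ENNReal.ofReal a * M) := meas_ge_le_lintegral_div hf hc hc'
    _ ≤ M / (ENNReal.ofReal a * M) := by gcongr
    _ = ENNReal.ofReal (1 / a) := by
        rw [ENNReal.ofReal_div_of_pos ha, ENNReal.ofReal_one, ← ENNReal.mul_div_mul_right 1 _ hM0 hM,
          one_mul]
    _ ≤ _ := ENNReal.ofReal_le_ofReal hε

theorem regCov_empty {d : ℕ} (z : ℕ → EuclideanSpace ℝ (Fin d)) (κ : ℝ) :
    regCov (∅ : Finset ℕ) z κ = κ • 1 := by simp [regCov]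

theorem lintegral_exp_neg_mul_norm_sq (d : ℕ) {κ : ℝ} (hκ : 0 < κ) :
    ∫⁻ y : EuclideanSpace ℝ (Fin d), ENNReal.ofReal (Real.exp (-(1 / 2 * (κ * ‖y‖ ^ 2)))) =
      ENNReal.ofReal (Real.sqrt (κ ^ d))⁻¹ * gaussianMass d := by
  have h := lintegral_exp_neg_quadratic (posDef_regCov (d := d) (∅ : Finset ℕ) (fun _ => 0) hκ)
  simp only [dotProduct_regCov_mulVec, Finset.sum_empty, zero_add] at h
  rw [regCov_empty, Matrix.det_smul, Matrix.det_one, Fintype.card_fin, mul_one] at h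
  rw [← h]
  refine lintegral_congr fun y => ?_
  ring_nf

/-- By Tonelli the mean of the mixture is the mixture of the means, all equal to one, which leaves
only the Gaussian weight with parameter `κ`. -/
theorem IsStdNoise.lintegral_mixture_eq [IsProbabilityMeasure P] (hg : IsStdNoise P g)
    {Z : ℕ → Ω → EuclideanSpace ℝ (Fin d)} (hZ : IsNonanticipating P Z g)
    {u : EuclideanSpace ℝ (Fin d)} (hu : ‖u‖ = 1) (T : ℕ) {κ : ℝ} (hκ : 0 < κ) :
    Measurable (fun ω => ∫⁻ y : EuclideanSpace ℝ (Fin d), ENNReal.ofReal (Real.exp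
      (inner ℝ y (∑ t ∈ Finset.range T, inner ℝ u (g t ω) • Z t ω) -
        1 / 2 * ((∑ t ∈ Finset.range T, inner ℝ y (Z t ω) ^ 2) + κ * ‖y‖ ^ 2)))) ∧
    ∫⁻ ω, (∫⁻ y : EuclideanSpace ℝ (Fin d), ENNReal.ofReal (Real.exp
      (inner ℝ y (∑ t ∈ Finset.range T, inner ℝ u (g t ω) • Z t ω) -
        1 / 2 * ((∑ t ∈ Finset.range T, inner ℝ y (Z t ω) ^ 2) + κ * ‖y‖ ^ 2)))) ∂P =
      ENNReal.ofReal (Real.sqrt (κ ^ d))⁻¹ * gaussianMass d := by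
  set f : Ω → EuclideanSpace ℝ (Fin d) → ENNReal := fun ω y => ENNReal.ofReal (Real.exp
      (inner ℝ y (∑ t ∈ Finset.range T, inner ℝ u (g t ω) • Z t ω) -
        1 / 2 * ((∑ t ∈ Finset.range T, inner ℝ y (Z t ω) ^ 2) + κ * ‖y‖ ^ 2))) with hf
  have hfm : Measurable (Function.uncurry f) := by
    have h1 := hg.measurable
    have h2 := hZ.measurable
    simp only [hf, Function.uncurry_def]
    fun_prop
  refine ⟨hfm.lintegral_prod_right', ?_⟩
  rw [lintegral_lintegral_swap hfm.aemeasurable, ← lintegral_exp_neg_mul_norm_sq d hκ]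
  refine lintegral_congr fun y => ?_
  calc _ = ∫⁻ ω, ENNReal.ofReal (Real.exp (∑ t ∈ Finset.range T,
      (inner ℝ y (Z t ω) * inner ℝ u (g t ω) - 1 / 2 * inner ℝ y (Z t ω) ^ 2))) *
      ENNReal.ofReal (Real.exp (-(1 / 2 * (κ * ‖y‖ ^ 2)))) ∂P := by
        refine lintegral_congr fun ω => ?_
        rw [← ENNReal.ofReal_mul (Real.exp_nonneg _), ← Real.exp_add]
        simp only [f]
        congr 2
        rw [inner_sum, Finset.sum_sub_distrib, ← Finset.mul_sum]
        have : ∑ t ∈ Finset.range T, inner ℝ y (inner ℝ u (g t ω) • Z t ω) =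
            ∑ t ∈ Finset.range T, inner ℝ y (Z t ω) * inner ℝ u (g t ω) :=
          Finset.sum_congr rfl fun t _ => by rw [real_inner_smul_right, mul_comm]
        rw [this]
        ring
    _ = _ := by
        rw [lintegral_mul_const' _ _ ENNReal.ofReal_ne_top, hg.lintegral_exp_sum_eq_one hZ hu,
          one_mul]

/-- The self-normalized deviation bound for least squares noise terms: with high probability,
`‖∑ ⟪w, Z_t⟫ g_t‖²` is controlled by `∑ ⟪w, Z_t⟫² + κ ‖w‖²` simultaneously for all `w`. -/
theorem IsStdNoise.measure_not_selfNormalized_le [IsProbabilityMeasure P] (hd : 1 ≤ d)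
    (hg : IsStdNoise P g)
    {Z : ℕ → Ω → EuclideanSpace ℝ (Fin d)} (hZ : IsNonanticipating P Z g)
    {T : ℕ} (hT : 1 ≤ T) {Γ : Matrix (Fin d) (Fin d) ℝ} (hΓ : Γ.PosDef)
    (hΓ1 : ∀ w : EuclideanSpace ℝ (Fin d), ‖w‖ ^ 2 ≤ w.ofLp ⬝ᵥ (Γ *ᵥ w.ofLp))
    (hmom : ∀ t < T, ∀ w : EuclideanSpace ℝ (Fin d),
      ∫⁻ ω, ENNReal.ofReal (inner ℝ w (Z t ω) ^ 2) ∂P ≤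
        ENNReal.ofReal (w.ofLp ⬝ᵥ (Γ *ᵥ w.ofLp)))
    {ε κ : ℝ} (hε : 0 < ε) (hκ : 0 < κ) :
    P {ω | ¬ ∀ w : EuclideanSpace ℝ (Fin d),
      ‖∑ t ∈ Finset.range T, inner ℝ w (Z t ω) • g t ω‖ ^ 2 ≤
        8 * (Real.log (5 ^ d / ε) + Real.log (Γ.det * (T / ε + κ) ^ d / κ ^ d) / 2) *
          (∑ t ∈ Finset.range T, inner ℝ w (Z t ω) ^ 2 + κ * ‖w‖ ^ 2)} ≤
      ENNReal.ofReal (2 * ε) := by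
  obtain ⟨N, hcard, hN1, hN⟩ := exists_half_net_sphere (EuclideanSpace ℝ (Fin d))
  rw [finrank_euclideanSpace_fin] at hcard
  obtain ⟨w, hw1, hwdet⟩ := hΓ.exists_normalizing_vectors hd
  have hT0 : (0 : ℝ) < T := by exact_mod_cast hT
  have hd0 : (0 : ℝ) < d := by exact_mod_cast hd
  set L := Real.log (5 ^ d / ε) + Real.log (Γ.det * (T / ε + κ) ^ d / κ ^ d) / 2 with hL
  set m0 : ENNReal := ENNReal.ofReal (Real.sqrt (κ ^ d))⁻¹ * gaussianMass d with hm0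
  have hm0' : m0 ≠ 0 := mul_ne_zero (by simp; positivity) (gaussianMass_pos d)
  have hm0t : m0 ≠ ⊤ := ENNReal.mul_ne_top ENNReal.ofReal_ne_top (gaussianMass_ne_top d)
  set F : EuclideanSpace ℝ (Fin d) → Ω → ENNReal := fun u ω =>
    ∫⁻ y : EuclideanSpace ℝ (Fin d), ENNReal.ofReal (Real.exp
      (inner ℝ y (∑ t ∈ Finset.range T, inner ℝ u (g t ω) • Z t ω) -
        1 / 2 * ((∑ t ∈ Finset.range T, inner ℝ y (Z t ω) ^ 2) + κ * ‖y‖ ^ 2))) with hF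
  -- The trace of the empirical covariance normalized by `Γ`. Its mean is at most `d T`, so Markov's
  -- inequality bounds it by `d T / ε`, and hence bounds the determinant.
  set G : Ω → ENNReal := fun ω =>
    ∑ i, ∑ t ∈ Finset.range T, ENNReal.ofReal (inner ℝ (w i) (Z t ω) ^ 2) with hG
  have hZm := hZ.measurable
  have hGm : Measurable G := by fun_prop
  have hGint : ∫⁻ ω, G ω ∂P ≤ ENNReal.ofReal (d * T) := by
    rw [hG, lintegral_finsetSum _ fun i _ => by fun_prop]
    calc _ ≤ ∑ _i : Fin d, ∑ _t ∈ Finset.range T, (1 : ENNReal) := by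
          refine Finset.sum_le_sum fun i _ => ?_
          rw [lintegral_finsetSum _ fun i _ => by fun_prop]
          refine Finset.sum_le_sum fun t ht => ?_
          refine (hmom t (Finset.mem_range.mp ht) (w i)).trans ?_
          rw [hw1 i, ENNReal.ofReal_one]
      _ = _ := by
          rw [ENNReal.ofReal_mul (by positivity)]; simp
  set bad1 : Set Ω := {ω | ENNReal.ofReal (1 / ε) * ENNReal.ofReal (d * T) < G ω} with hbad1
  -- The threshold factor `5^d / ε` pays for the union over at most `5^d` net directions.
  set bad2 : EuclideanSpace ℝ (Fin d) → Set Ω :=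
    fun u => {ω | ENNReal.ofReal (5 ^ d / ε) * m0 < F u ω} with hbad2
  have hP1 : P bad1 ≤ ENNReal.ofReal ε :=
    measure_lt_le_of_lintegral_le hGm.aemeasurable
      (ENNReal.ofReal_pos.mpr (by positivity)).ne' ENNReal.ofReal_ne_top
      (by positivity) (by simp) hGint
  have hP2 : ∀ u ∈ N, P (bad2 u) ≤ ENNReal.ofReal (ε / 5 ^ d) := by
    intro u hu
    obtain ⟨h1, h2⟩ := hg.lintegral_mixture_eq hZ (hN1 u hu) T hκ
    exact measure_lt_le_of_lintegral_le h1.aemeasurable hm0' hm0t (by positivity)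
      (by rw [one_div_div]) h2.le
  have hsub : {ω | ¬ ∀ w : EuclideanSpace ℝ (Fin d),
      ‖∑ t ∈ Finset.range T, inner ℝ w (Z t ω) • g t ω‖ ^ 2 ≤
        8 * L * (∑ t ∈ Finset.range T, inner ℝ w (Z t ω) ^ 2 + κ * ‖w‖ ^ 2)} ⊆
      bad1 ∪ ⋃ u ∈ N, bad2 u := by
    intro ω hω
    by_contra hcon
    apply hω
    simp only [hbad1, hbad2, Set.mem_union, Set.mem_iUnion, Set.mem_ofPred_eq, not_or, not_exists,
      not_lt] at hcon
    obtain ⟨c1, c2⟩ := hcon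
    have htr : ∑ i, ∑ t ∈ Finset.range T, inner ℝ (w i) (Z t ω) ^ 2 ≤ d * (T / ε) := by
      have e : G ω = ENNReal.ofReal (∑ i, ∑ t ∈ Finset.range T, inner ℝ (w i) (Z t ω) ^ 2) := by
        rw [ENNReal.ofReal_sum_of_nonneg fun i _ => Finset.sum_nonneg fun t _ => sq_nonneg _]
        refine Finset.sum_congr rfl fun i _ => ?_
        rw [ENNReal.ofReal_sum_of_nonneg fun t _ => sq_nonneg _]
      rw [e, ← ENNReal.ofReal_mul (by positivity), ENNReal.ofReal_le_ofReal_iff (by positivity)] at c1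
      refine c1.trans (le_of_eq ?_)
      field_simp
    have hdet : (regCov (Finset.range T) (fun t => Z t ω) κ).det ≤ Γ.det * (T / ε + κ) ^ d := by
      refine hwdet _ _ (posSemidef_regCov _ _ hκ.le) ?_
      simp only [dotProduct_regCov_mulVec]
      rw [Finset.sum_add_distrib, mul_add]
      refine add_le_add htr ?_
      calc ∑ i, κ * ‖w i‖ ^ 2 ≤ ∑ _i : Fin d, κ * 1 := by
            refine Finset.sum_le_sum fun i _ => ?_
            have := hΓ1 (w i)
            rw [hw1 i] at this
            gcongr
        _ = d * κ := by simp
    intro v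
    set q := ∑ t ∈ Finset.range T, inner ℝ v (Z t ω) ^ 2 + κ * ‖v‖ ^ 2 with hq
    have hu2 : ∀ u ∈ N, inner ℝ (∑ t ∈ Finset.range T, inner ℝ v (Z t ω) • g t ω) u ^ 2 ≤
        2 * L * q := by
      intro u hu
      have h := inner_sq_le_of_lintegral_le (Finset.range T) (fun t => Z t ω)
        (∑ t ∈ Finset.range T, inner ℝ u (g t ω) • Z t ω) hκ (b := 5 ^ d / ε) (by positivity) hdet
        (c2 u hu) v
      have e : inner ℝ (∑ t ∈ Finset.range T, inner ℝ v (Z t ω) • g t ω) u =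
          inner ℝ v (∑ t ∈ Finset.range T, inner ℝ u (g t ω) • Z t ω) := by
        rw [sum_inner, inner_sum]
        refine Finset.sum_congr rfl fun t _ => ?_
        rw [real_inner_smul_left, real_inner_smul_right, real_inner_comm u, mul_comm]
      rw [e]; exact h
    have hLq : ‖∑ t ∈ Finset.range T, inner ℝ v (Z t ω) • g t ω‖ ≤ 2 * Real.sqrt (2 * L * q) :=
      norm_le_two_mul_of_half_net hN (Real.sqrt_nonneg _) fun u hu => Real.abs_le_sqrt (hu2 u hu)
    -- The sign of `L` is not known in advance; it is the existence of a net point, hence `d ≥ 1`,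
    -- that makes this bound on a square nonnegative.
    have hnn : 0 ≤ 2 * L * q := by
      have : Nonempty (Fin d) := ⟨⟨0, hd⟩⟩
      obtain ⟨x, hx⟩ : ∃ x : EuclideanSpace ℝ (Fin d), ‖x‖ = 1 := exists_norm_eq _ zero_le_one
      obtain ⟨u, hu, -⟩ := hN x hx
      exact (sq_nonneg _).trans (hu2 u hu)
    calc _ ≤ (2 * Real.sqrt (2 * L * q)) ^ 2 := by gcongr
      _ = 8 * L * q := by rw [mul_pow, Real.sq_sqrt hnn]; ring
  refine (measure_mono hsub).trans ((measure_union_le _ _).trans ?_)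
  have hP3 : P (⋃ u ∈ N, bad2 u) ≤ ENNReal.ofReal ε := by
    refine (measure_biUnion_finset_le _ _).trans ((Finset.sum_le_card_nsmul _ _ _ hP2).trans ?_)
    rw [nsmul_eq_mul, ← ENNReal.ofReal_natCast, ← ENNReal.ofReal_mul (by positivity)]
    refine ENNReal.ofReal_le_ofReal ?_
    have : (N.card : ℝ) ≤ 5 ^ d := by exact_mod_cast hcard
    calc (N.card : ℝ) * (ε / 5 ^ d) ≤ 5 ^ d * (ε / 5 ^ d) := by gcongr
      _ = ε := by field_simp
  rw [two_mul, ENNReal.ofReal_add hε.le hε.le]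
  exact add_le_add hP1 hP3

end

/-! ### Second moments and measurability of the state -/

theorem inner_toEuclideanCLM {d : ℕ} (A : Matrix (Fin d) (Fin d) ℝ)
    (w x : EuclideanSpace ℝ (Fin d)) :
    inner ℝ w (Matrix.toEuclideanCLM (n := Fin d) (𝕜 := ℝ) A x) =
      inner ℝ (Matrix.toEuclideanCLM (n := Fin d) (𝕜 := ℝ) Aᵀ w) x := by
  simp only [EuclideanSpace.inner_eq_star_dotProduct, Matrix.ofLp_toEuclideanCLM, star_trivial]
  rw [Matrix.mulVec_transpose, dotProduct_comm, Matrix.dotProduct_mulVec, dotProduct_comm]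

theorem dotProduct_gramian_mulVec {d : ℕ} (A : Matrix (Fin d) (Fin d) ℝ) (t : ℕ)
    (w : EuclideanSpace ℝ (Fin d)) : w.ofLp ⬝ᵥ (gramian A t *ᵥ w.ofLp) =
      ∑ s ∈ Finset.range t, ‖Matrix.toEuclideanCLM (n := Fin d) (𝕜 := ℝ) (A ^ s)ᵀ w‖ ^ 2 := by
  rw [gramian, Matrix.sum_mulVec, dotProduct_sum]
  refine Finset.sum_congr rfl fun s _ => ?_
  rw [EuclideanSpace.real_norm_sq_eq, ← Matrix.mulVec_mulVec, Matrix.dotProduct_mulVec,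
    ← Matrix.mulVec_transpose]
  simp [dotProduct, sq, -Matrix.transpose_pow]

theorem dotProduct_gramian_succ {d : ℕ} (A : Matrix (Fin d) (Fin d) ℝ) (t : ℕ)
    (w : EuclideanSpace ℝ (Fin d)) : w.ofLp ⬝ᵥ (gramian A (t + 1) *ᵥ w.ofLp) =
      (Matrix.toEuclideanCLM (n := Fin d) (𝕜 := ℝ) Aᵀ w).ofLp ⬝ᵥ
        (gramian A t *ᵥ (Matrix.toEuclideanCLM (n := Fin d) (𝕜 := ℝ) Aᵀ w).ofLp) + ‖w‖ ^ 2 := by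
  rw [dotProduct_gramian_mulVec, dotProduct_gramian_mulVec, Finset.sum_range_succ']
  congr 1
  · refine Finset.sum_congr rfl fun s _ => ?_
    rw [pow_succ' A s, Matrix.transpose_mul, map_mul]; rfl
  · simp

theorem dotProduct_gramian_mono {d : ℕ} (A : Matrix (Fin d) (Fin d) ℝ) {k t : ℕ} (h : k ≤ t)
    (w : EuclideanSpace ℝ (Fin d)) :
    w.ofLp ⬝ᵥ (gramian A k *ᵥ w.ofLp) ≤ w.ofLp ⬝ᵥ (gramian A t *ᵥ w.ofLp) := by
  rw [dotProduct_gramian_mulVec, dotProduct_gramian_mulVec]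
  exact Finset.sum_le_sum_of_subset_of_nonneg (Finset.range_mono h) fun _ _ _ => by positivity

theorem norm_sq_le_dotProduct_gramian {d : ℕ} (A : Matrix (Fin d) (Fin d) ℝ) {t : ℕ} (h : 1 ≤ t)
    (w : EuclideanSpace ℝ (Fin d)) : ‖w‖ ^ 2 ≤ w.ofLp ⬝ᵥ (gramian A t *ᵥ w.ofLp) := by
  refine le_trans (le_of_eq ?_) (dotProduct_gramian_mono A h w)
  rw [dotProduct_gramian_mulVec]; simp

theorem posDef_gramian {d : ℕ} (A : Matrix (Fin d) (Fin d) ℝ) {t : ℕ} (h : 1 ≤ t) :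
    (gramian A t).PosDef := by
  obtain ⟨t, rfl⟩ := Nat.exists_eq_add_of_le' h
  rw [gramian, Finset.sum_range_succ', pow_zero, Matrix.transpose_one, mul_one]
  refine Matrix.PosDef.posSemidef_add (Matrix.posSemidef_sum _ fun s _ => ?_) Matrix.PosDef.one
  simpa using Matrix.posSemidef_self_mul_conjTranspose (A ^ (s + 1))

section
variable {d : ℕ} {Ω : Type u} {mΩ : MeasurableSpace Ω} {P : Measure Ω}
  {g : ℕ → Ω → EuclideanSpace ℝ (Fin d)}

theorem measurable_state_history (A : Matrix (Fin d) (Fin d) ℝ) (t : ℕ) :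
    Measurable[⨆ i ∈ {i | i < t}, MeasurableSpace.comap (g i) inferInstance] (state A g t) := by
  induction t with
  | zero => exact measurable_const
  | succ t ih =>
    set m := ⨆ i ∈ {i | i < t + 1}, MeasurableSpace.comap (g i) inferInstance with hm
    have h1 : Measurable[m] (state A g t) :=
      ih.mono (biSup_mono fun i (hi : i < t) => show i < t + 1 by omega) le_rfl
    have h2 : Measurable[m] (g t) :=
      (comap_measurable (g t)).mono
        (le_biSup (fun i => MeasurableSpace.comap (g i) inferInstance)
          (show t ∈ {i | i < t + 1} from Nat.lt_succ_self t)) le_rfl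
    have h3 : Measurable (Matrix.toEuclideanCLM (n := Fin d) (𝕜 := ℝ) A) := by fun_prop
    exact (h3.comp h1).add h2

/-- The filtration at time `t` is generated by `g_i` with `i < t + k`. Offset `0` serves the pair `A
X_t`, `g_t`, and offset `1` the pair `X_{t+1}`, `g_{t+1}`. -/
theorem IsStdNoise.isNonanticipating (hg : IsStdNoise P g) (k : ℕ)
    {Z : ℕ → Ω → EuclideanSpace ℝ (Fin d)}
    (hZ : ∀ t, Measurable[⨆ i ∈ {i | i < t + k}, MeasurableSpace.comap (g i) inferInstance] (Z t)) :
    IsNonanticipating P Z fun t => g (t + k) := by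
  have hle : ∀ i, MeasurableSpace.comap (g i) inferInstance ≤ mΩ := fun i =>
    (hg.measurable i).comap_le
  refine ⟨fun t => ⨆ i ∈ {i | i < t + k}, MeasurableSpace.comap (g i) inferInstance,
    fun t => iSup₂_le fun i _ => hle i, fun s t hst => biSup_mono fun i (hi : i < s + k) =>
      show i < t + k by omega, hZ, fun t => ?_, fun t => ?_⟩
  · exact (comap_measurable (g (t + k))).mono
        (le_biSup (fun i => MeasurableSpace.comap (g i) inferInstance)
          (show t + k ∈ {i | i < t + 1 + k} by simp)) le_rfl
  · have h := indep_iSup_of_disjoint hle hg.indep.iIndep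
      (S := {i | i < t + k}) (T := {t + k}) (by simp)
    simpa using h

theorem IsStdNoise.shift (hg : IsStdNoise P g) (k : ℕ) : IsStdNoise P fun t => g (t + k) where
  measurable t := hg.measurable (t + k)
  indep := hg.indep.precomp (add_left_injective k)
  map_inner t u := hg.map_inner (t + k) u

/-- The new noise is centred and independent of the state, so the second moment at `w` is the
previous one at `Aᵀ w` plus `‖w‖²`, which is the recursion `dotProduct_gramian_succ`. -/
theorem IsStdNoise.lintegral_inner_state_sq [IsProbabilityMeasure P] (hg : IsStdNoise P g)
    (A : Matrix (Fin d) (Fin d) ℝ) (t : ℕ) (w : EuclideanSpace ℝ (Fin d)) :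
    ∫⁻ ω, ENNReal.ofReal (inner ℝ w (state A g t ω) ^ 2) ∂P =
      ENNReal.ofReal (w.ofLp ⬝ᵥ (gramian A t *ᵥ w.ofLp)) := by
  induction t generalizing w with
  | zero => simp [state, gramian]
  | succ t ih =>
    obtain ⟨m, hm, -, hZm, -, hind⟩ :=
      (hg.isNonanticipating 0 (Z := state A g) (measurable_state_history A)).exists_filtration
    have hXt := hZm t
    have hY : Measurable[m t] fun ω => (inner ℝ (Matrix.toEuclideanCLM (n := Fin d) (𝕜 := ℝ) Aᵀ w)
        (state A g t ω) : ℝ) := by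
      fun_prop
    have hind' : Indep (m t) (MeasurableSpace.comap (fun ω => inner ℝ w (g t ω)) inferInstance) P := by
      refine indep_of_indep_of_le_right (hind t) ?_
      have hin : Measurable fun x : EuclideanSpace ℝ (Fin d) => (inner ℝ w x : ℝ) := by fun_prop
      have : (fun ω => (inner ℝ w (g t ω) : ℝ)) = (fun x => inner ℝ w x) ∘ g t := rfl
      rw [this, ← MeasurableSpace.comap_comp]
      exact MeasurableSpace.comap_mono hin.comap_le
    have hkey := lintegral_comp_of_indep (hm t) hY (hg.measurable_inner t w) hind'
      (f := fun a x => ENNReal.ofReal ((a + x) ^ 2)) (by simp only [Function.uncurry_def]; fun_prop)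
    rw [hg.map_inner t w] at hkey
    calc _ = ∫⁻ ω, ENNReal.ofReal ((inner ℝ (Matrix.toEuclideanCLM (n := Fin d) (𝕜 := ℝ) Aᵀ w)
          (state A g t ω) + inner ℝ w (g t ω)) ^ 2) ∂P := by
          refine lintegral_congr fun ω => ?_
          rw [state, inner_add_right, inner_toEuclideanCLM]
      _ = _ := hkey
      _ = ∫⁻ ω, (ENNReal.ofReal (inner ℝ (Matrix.toEuclideanCLM (n := Fin d) (𝕜 := ℝ) Aᵀ w)
          (state A g t ω) ^ 2) + ENNReal.ofReal (‖w‖ ^ 2)) ∂P := by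
          refine lintegral_congr fun ω => ?_
          rw [lintegral_add_sq_gaussianReal, ENNReal.ofReal_add (sq_nonneg _) (by positivity)]
          simp
      _ = _ := by
          rw [lintegral_add_right _ measurable_const, ih, dotProduct_gramian_succ,
            ENNReal.ofReal_add _ (by positivity)]
          · simp
          · rw [dotProduct_gramian_mulVec]
            exact Finset.sum_nonneg fun _ _ => by positivity

end

/-! ### Deterministic analysis of least squares -/

theorem toEuclideanCLM_vecMulVec {d : ℕ} (v w x : EuclideanSpace ℝ (Fin d)) :
    Matrix.toEuclideanCLM (n := Fin d) (𝕜 := ℝ) (Matrix.vecMulVec v.ofLp w.ofLp) x =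
      inner ℝ w x • v := by
  apply WithLp.ofLp_injective
  rw [Matrix.ofLp_toEuclideanCLM, Matrix.vecMulVec_mulVec, EuclideanSpace.inner_eq_star_dotProduct]
  ext i
  simp [dotProduct_comm, mul_comm]

/-- The normal equations for a least squares estimate. -/
theorem IsOLS.sum_inner_mul_inner_eq_zero {d : ℕ} {x : ℕ → EuclideanSpace ℝ (Fin d)} {T : ℕ}
    {B : Matrix (Fin d) (Fin d) ℝ} (hB : IsOLS x T B) (v w : EuclideanSpace ℝ (Fin d)) :
    ∑ t ∈ Finset.Icc 1 T, inner ℝ w (x t) *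
      inner ℝ v (x (t + 1) - Matrix.toEuclideanCLM (n := Fin d) (𝕜 := ℝ) B (x t)) = 0 := by
  set r : ℕ → EuclideanSpace ℝ (Fin d) :=
    fun t => x (t + 1) - Matrix.toEuclideanCLM (n := Fin d) (𝕜 := ℝ) B (x t) with hr
  set b := ∑ t ∈ Finset.Icc 1 T, inner ℝ w (x t) * inner ℝ v (r t)
  set c := ∑ t ∈ Finset.Icc 1 T, 1 / 2 * inner ℝ w (x t) ^ 2 * ‖v‖ ^ 2
  have hc : 0 ≤ c := Finset.sum_nonneg fun _ _ => by positivity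
  -- Compare `B` with its rank-one perturbation `B + s v wᵀ`.
  have key : ∀ s : ℝ, 0 ≤ s ^ 2 * c - s * b := by
    intro s
    have h := hB (Set.mem_univ (B + s • Matrix.vecMulVec v.ofLp w.ofLp))
    simp only [Set.mem_ofPred_eq] at h
    have e : ∀ t, (1 / 2 : ℝ) * ‖x (t + 1) - Matrix.toEuclideanCLM (n := Fin d) (𝕜 := ℝ)
        (B + s • Matrix.vecMulVec v.ofLp w.ofLp) (x t)‖ ^ 2 = 1 / 2 * ‖r t‖ ^ 2 -
        s * (inner ℝ w (x t) * inner ℝ v (r t)) +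
        s ^ 2 * (1 / 2 * inner ℝ w (x t) ^ 2 * ‖v‖ ^ 2) := by
      intro t
      have e1 : x (t + 1) - Matrix.toEuclideanCLM (n := Fin d) (𝕜 := ℝ)
          (B + s • Matrix.vecMulVec v.ofLp w.ofLp) (x t) = r t - (s * inner ℝ w (x t)) • v := by
        rw [map_add, map_smul, add_apply, smul_apply,
          toEuclideanCLM_vecMulVec, smul_smul, hr,
          sub_add_eq_sub_sub]
      rw [e1, norm_sub_sq_real, real_inner_smul_right, norm_smul, mul_pow, Real.norm_eq_abs, sq_abs,
        real_inner_comm v (r t)]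
      ring
    simp only [e] at h
    rw [Finset.sum_add_distrib, Finset.sum_sub_distrib, ← Finset.mul_sum, ← Finset.mul_sum,
      ← Finset.mul_sum] at h
    simp only [b, c]
    linarith
  -- Near the minimizer in `s`; `c + 1` instead of `c` avoids a division by zero.
  have h := key (b / (c + 1))
  have e : (b / (c + 1)) ^ 2 * c - b / (c + 1) * b = -(b / (c + 1)) ^ 2 := by
    field_simp; ring
  rw [e] at h
  have h2 : b / (c + 1) = 0 := by nlinarith [sq_nonneg (b / (c + 1))]
  rcases div_eq_zero_iff.mp h2 with h3 | h3
  · exact h3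
  · linarith

theorem sum_Icc_one_eq_sum_range {M : Type*} [AddCommMonoid M] (f : ℕ → M) (T : ℕ) :
    ∑ t ∈ Finset.Icc 1 T, f t = ∑ t ∈ Finset.range T, f (t + 1) := by
  rw [← Finset.Ico_add_one_right_eq_Icc, Finset.sum_Ico_eq_sum_range]
  simp [add_comm]

/-- The empirical covariance is bounded below if the noise is well conditioned and the cross terms
are self-normalized. -/
theorem sum_inner_add_sq_ge {E : Type*} [NormedAddCommGroup E] [InnerProductSpace ℝ E] (T : ℕ)
    (a n : ℕ → E) {L : ℝ} (hL : 0 ≤ L) (hLT : 64 * L ≤ T) (v : E)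
    (h0 : 1 / 2 * T * ‖v‖ ^ 2 ≤ ∑ t ∈ Finset.range T, inner ℝ v (n t) ^ 2)
    (h1 : ‖∑ t ∈ Finset.range T, inner ℝ v (a t) • n t‖ ^ 2 ≤
      8 * L * (∑ t ∈ Finset.range T, inner ℝ v (a t) ^ 2 + T / 8 * ‖v‖ ^ 2)) :
    1 / 4 * T * ‖v‖ ^ 2 ≤ ∑ t ∈ Finset.range T, inner ℝ v (a t + n t) ^ 2 := by
  set c := ∑ t ∈ Finset.range T, inner ℝ v (a t) • n t with hc
  set p := ∑ t ∈ Finset.range T, inner ℝ v (a t) ^ 2 with hp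
  have hp0 : 0 ≤ p := Finset.sum_nonneg fun _ _ => sq_nonneg _
  have e : ∑ t ∈ Finset.range T, inner ℝ v (a t + n t) ^ 2 =
      p + 2 * inner ℝ v c + ∑ t ∈ Finset.range T, inner ℝ v (n t) ^ 2 := by
    rw [hc, inner_sum, hp, Finset.mul_sum, ← Finset.sum_add_distrib, ← Finset.sum_add_distrib]
    refine Finset.sum_congr rfl fun t _ => ?_
    rw [inner_add_right, real_inner_smul_right]; ring
  set y := p + T / 8 * ‖v‖ ^ 2
  have hy : 0 ≤ y := by positivity
  have h2 := (abs_le.mp (abs_real_inner_le_norm v c)).1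
  have h3 : ‖c‖ ≤ Real.sqrt (8 * L * y) := Real.le_sqrt_of_sq_le h1
  -- The `p` contained in `y` cancels against the signal term, and `8 L ≤ T/8`, so `T/2 - T/8 - T/8
  -- = T/4` remains.
  have h4 : 2 * (‖v‖ * ‖c‖) ≤ y + 8 * L * ‖v‖ ^ 2 := by
    have h5 : ‖v‖ * ‖c‖ ≤ ‖v‖ * Real.sqrt (8 * L * y) := by gcongr
    have h6 := sq_nonneg (Real.sqrt y - Real.sqrt (8 * L) * ‖v‖)
    rw [Real.sqrt_mul (by positivity)] at h5
    have h7 := Real.sq_sqrt hy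
    have h8 := Real.sq_sqrt (show 0 ≤ 8 * L by positivity)
    nlinarith
  have h9 : 8 * L * ‖v‖ ^ 2 ≤ T / 8 * ‖v‖ ^ 2 := by gcongr; linarith
  have h10 : y = p + T / 8 * ‖v‖ ^ 2 := rfl
  rw [e]
  linarith

/-- The deterministic part of the analysis of ordinary least squares. -/
theorem IsOLS.opNorm_sub_le {d : ℕ} {x : ℕ → EuclideanSpace ℝ (Fin d)} {T : ℕ} (hT : 1 ≤ T)
    {B : Matrix (Fin d) (Fin d) ℝ} (hB : IsOLS x T B) (A : Matrix (Fin d) (Fin d) ℝ)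
    (n : ℕ → EuclideanSpace ℝ (Fin d))
    (hx : ∀ t, x (t + 1) = Matrix.toEuclideanCLM (n := Fin d) (𝕜 := ℝ) A (x t) + n t)
    {L : ℝ} (hL : 0 ≤ L)
    (hV : ∀ w : EuclideanSpace ℝ (Fin d),
      1 / 4 * T * ‖w‖ ^ 2 ≤ ∑ t ∈ Finset.range T, inner ℝ w (x (t + 1)) ^ 2)
    (h2 : ∀ w : EuclideanSpace ℝ (Fin d),
      ‖∑ t ∈ Finset.range T, inner ℝ w (x (t + 1)) • n (t + 1)‖ ^ 2 ≤
      8 * L * (∑ t ∈ Finset.range T, inner ℝ w (x (t + 1)) ^ 2 + T / 8 * ‖w‖ ^ 2)) :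
    opNorm (B - A) ≤ 8 * Real.sqrt (L / T) := by
  have hT0 : (0 : ℝ) < T := by exact_mod_cast hT
  set Δ := Matrix.toEuclideanCLM (n := Fin d) (𝕜 := ℝ) (B - A) with hΔ
  set Δ' := Matrix.toEuclideanCLM (n := Fin d) (𝕜 := ℝ) (B - A)ᵀ with hΔ'
  have hdual : ∀ v y, inner ℝ v (Δ y) = inner ℝ (Δ' v) y := inner_toEuclideanCLM (B - A)
  have hres : ∀ t, x (t + 1) - Matrix.toEuclideanCLM (n := Fin d) (𝕜 := ℝ) B (x t) =
      n t - Δ (x t) := by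
    intro t
    rw [hx, hΔ, map_sub, sub_apply]; abel
  -- At `w = Δ' v` the normal equations read `q = ⟪v, c⟫`. Since `‖c‖² ≤ 12 L q`, this gives `q ≤ 12
  -- L ‖v‖²`, while `q ≥ (T/4) ‖w‖²`; the resulting `48` is rounded up to `64`.
  have hΔv : ∀ v, ‖Δ' v‖ ≤ 8 * Real.sqrt (L / T) * ‖v‖ := by
    intro v
    set w := Δ' v with hw
    have h := hB.sum_inner_mul_inner_eq_zero v w
    simp only [hres, sum_Icc_one_eq_sum_range] at h
    set q := ∑ t ∈ Finset.range T, inner ℝ w (x (t + 1)) ^ 2 with hq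
    set c := ∑ t ∈ Finset.range T, inner ℝ w (x (t + 1)) • n (t + 1) with hc
    have e : inner ℝ v c = q := by
      have : inner ℝ v c - q = 0 := by
        rw [← h, hc, hq, inner_sum, ← Finset.sum_sub_distrib]
        refine Finset.sum_congr rfl fun t _ => ?_
        rw [real_inner_smul_right, inner_sub_right, hdual, ← hw]; ring
      linarith
    have hVw := hV w
    have hq0 : 0 ≤ q := Finset.sum_nonneg fun _ _ => sq_nonneg _
    have h5 : q ≤ ‖v‖ * ‖c‖ := by rw [← e]; exact real_inner_le_norm v c
    have h6 : ‖c‖ ^ 2 ≤ 12 * L * q := by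
      refine (h2 w).trans ?_
      have : 8 * L * (q + T / 8 * ‖w‖ ^ 2) ≤ 8 * L * (q + 1 / 2 * q) :=
        mul_le_mul_of_nonneg_left (by linarith) (by positivity)
      linarith
    have h7 : q ≤ 12 * L * ‖v‖ ^ 2 := by
      rcases hq0.eq_or_lt with h0 | h0
      · rw [← h0]; positivity
      · have : q * q ≤ 12 * L * ‖v‖ ^ 2 * q := by
          calc q * q ≤ (‖v‖ * ‖c‖) * (‖v‖ * ‖c‖) := by gcongr
            _ = ‖v‖ ^ 2 * ‖c‖ ^ 2 := by ring
            _ ≤ ‖v‖ ^ 2 * (12 * L * q) := by gcongr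
            _ = _ := by ring
        exact le_of_mul_le_mul_right this h0
    have h8 : ‖w‖ ^ 2 ≤ (8 * Real.sqrt (L / T) * ‖v‖) ^ 2 := by
      rw [mul_pow, mul_pow, Real.sq_sqrt (by positivity)]
      have h9 : T * ‖w‖ ^ 2 ≤ 64 * L * ‖v‖ ^ 2 := by
        nlinarith [mul_nonneg hL (sq_nonneg ‖v‖)]
      calc ‖w‖ ^ 2 = (T * ‖w‖ ^ 2) / T := by field_simp
        _ ≤ (64 * L * ‖v‖ ^ 2) / T := by gcongr
        _ = _ := by ring
    exact le_of_sq_le_sq h8 (by positivity)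
  refine ContinuousLinearMap.opNorm_le_bound _ (by positivity) fun y => ?_
  change ‖Δ y‖ ≤ _
  rcases eq_or_ne (Δ y) 0 with h0 | h0
  · rw [h0, norm_zero]; positivity
  have h1 : ‖Δ y‖ * ‖Δ y‖ ≤ (8 * Real.sqrt (L / T) * ‖y‖) * ‖Δ y‖ := by
    calc ‖Δ y‖ * ‖Δ y‖ = inner ℝ (Δ y) (Δ y) := (real_inner_self_eq_norm_mul_norm _).symm
      _ = inner ℝ (Δ' (Δ y)) y := hdual _ _
      _ ≤ ‖Δ' (Δ y)‖ * ‖y‖ := real_inner_le_norm _ _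
      _ ≤ 8 * Real.sqrt (L / T) * ‖Δ y‖ * ‖y‖ := by gcongr; exact hΔv _
      _ = _ := by ring
  exact le_of_mul_le_mul_right h1 (norm_pos_iff.mpr h0)

/-! ### The high-probability error bound -/

theorem gramian_one {d : ℕ} (A : Matrix (Fin d) (Fin d) ℝ) : gramian A 1 = 1 := by
  simp [gramian]

/-- With `ε = δ/6` and `κ = T/8` proportional to `T`, the quotient `(T/ε + κ)/κ` is `48/δ + 1`, so
`T` enters only through `det Γ_T`. Numerical constants are absorbed using `log 2 ≤ log (1/δ)`. -/
theorem log_confidence_bounds {d T : ℕ} (hd : 1 ≤ d) (hT : 1 ≤ T)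
    (A : Matrix (Fin d) (Fin d) ℝ) {δ : ℝ} (hδ : 0 < δ) (hδ' : δ < 1 / 2) :
    (0 ≤ Real.log (5 ^ d / (δ / 6)) +
      Real.log ((gramian A T).det * (T / (δ / 6) + T / 8) ^ d / (T / 8) ^ d) / 2) ∧
    Real.log (5 ^ d / (δ / 6)) +
      Real.log ((gramian A T).det * (T / (δ / 6) + T / 8) ^ d / (T / 8) ^ d) / 2 ≤
      10 * blockComplexity A δ T 1 ∧
    Real.log (12 * 25 ^ d / δ) ≤ 10 * blockComplexity A δ T 1 := by
  have hT0 : (0 : ℝ) < T := by exact_mod_cast hT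
  have hd1 : (1 : ℝ) ≤ d := by exact_mod_cast hd
  have hdet := one_le_det_gramian A hT
  have hdet0 : 0 < (gramian A T).det := by linarith
  have hld := Real.log_nonneg hdet
  set l := Real.log (1 / δ) with hl
  have hl2 : Real.log 2 ≤ l := Real.log_le_log (by norm_num) (by rw [le_div_iff₀ hδ]; linarith)
  have h2pos : 0 < Real.log 2 := Real.log_pos (by norm_num)
  have hK : d * l + Real.log (gramian A T).det ≤ blockComplexity A δ T 1 := by
    rw [blockComplexity, gramian_one, inv_one, mul_one]
    have : l ≤ Real.log (d / δ) := Real.log_le_log (by positivity) (by gcongr)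
    gcongr
  have hpow : ∀ (x : ℝ) (k : ℕ), 0 < x → x ≤ 2 ^ k → Real.log x ≤ k * Real.log 2 := by
    intro x k hx h
    rw [← Real.log_pow]; exact Real.log_le_log hx h
  have e1 : Real.log (5 ^ d / (δ / 6)) = d * Real.log 5 + Real.log 6 + l := by
    rw [hl, ← Real.log_pow, ← Real.log_mul (by positivity) (by positivity),
      ← Real.log_mul (by positivity) (by positivity)]
    congr 1; field_simp
  have e2 : Real.log (12 * 25 ^ d / δ) = d * Real.log 25 + Real.log 12 + l := by
    rw [hl, ← Real.log_pow, ← Real.log_mul (by positivity) (by positivity),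
      ← Real.log_mul (by positivity) (by positivity)]
    congr 1; field_simp
  have e3 : Real.log ((gramian A T).det * (T / (δ / 6) + T / 8) ^ d / (T / 8) ^ d) =
      Real.log (gramian A T).det + d * Real.log (48 / δ + 1) := by
    rw [← Real.log_pow, ← Real.log_mul (by positivity) (by positivity), mul_div_assoc, ← div_pow]
    congr 3
    field_simp
    ring
  have h48 : Real.log (48 / δ + 1) ≤ 6 * Real.log 2 + l := by
    rw [hl]
    have h1 := hpow 64 6 (by norm_num) (by norm_num)
    have h2 : Real.log (48 / δ + 1) ≤ Real.log (64 * (1 / δ)) := by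
      apply Real.log_le_log (by positivity)
      rw [← sub_nonneg]
      have : 64 * (1 / δ) - (48 / δ + 1) = (16 - δ) / δ := by field_simp; ring
      rw [this]; exact div_nonneg (by linarith) hδ.le
    rw [Real.log_mul (by norm_num) (by positivity)] at h2
    push_cast at h1
    linarith
  have h48' : 0 ≤ Real.log (48 / δ + 1) := Real.log_nonneg (by
    have : 0 < 48 / δ := by positivity
    linarith)
  have h5 := hpow 5 3 (by norm_num) (by norm_num)
  have h6 := hpow 6 3 (by norm_num) (by norm_num)
  have h12 := hpow 12 4 (by norm_num) (by norm_num)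
  have h25 := hpow 25 5 (by norm_num) (by norm_num)
  push_cast at h5 h6 h12 h25
  have h5' : 0 ≤ Real.log 5 := Real.log_nonneg (by norm_num)
  have h6' : 0 ≤ Real.log 6 := Real.log_nonneg (by norm_num)
  have h30 : Real.log 5 + Real.log 6 ≤ 5 * Real.log 2 := by
    rw [← Real.log_mul (by norm_num) (by norm_num)]
    have := hpow 30 5 (by norm_num) (by norm_num)
    push_cast at this
    norm_num at this ⊢
    exact this
  have hll : l ≤ d * l := le_mul_of_one_le_left (by linarith) hd1
  have h6d : Real.log 6 ≤ d * Real.log 6 := le_mul_of_one_le_left h6' hd1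
  have h12d : Real.log 12 ≤ d * Real.log 12 :=
    le_mul_of_one_le_left (Real.log_nonneg (by norm_num)) hd1
  have hdd : ∀ x y : ℝ, x ≤ y → d * x ≤ d * y := fun x y h => by gcongr
  have a1 := hdd _ _ h30
  have a2 := hdd _ _ h48
  have a3 := hdd _ _ hl2
  have a4 := hdd _ _ h12
  have a5 := hdd _ _ h25
  have a6 := hdd _ _ h5'
  have a7 := hdd _ _ h48'
  rw [e1, e2, e3]
  refine ⟨?_, ?_, ?_⟩ <;> linarith

section
variable {d : ℕ} {Ω : Type u} {mΩ : MeasurableSpace Ω} {P : Measure Ω}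
  {g : ℕ → Ω → EuclideanSpace ℝ (Fin d)}

/-- Three events, each failing with probability at most `δ/3`: `S1` and `S3` together bound the
empirical covariance from below, and `S2` controls the noise in the normal equations. The constant
is `5120 = 512 · 10`, from the chi-square exponent and `log_confidence_bounds`. -/
theorem IsStdNoise.measure_not_ols_bound_le [IsProbabilityMeasure P] (hd : 1 ≤ d)
    (hg : IsStdNoise P g) (A : Matrix (Fin d) (Fin d) ℝ) {T : ℕ} (hT : 1 ≤ T)
    {δ : ℝ} (hδ : 0 < δ) (hδ' : δ < 1 / 2) (hadm : 5120 * blockComplexity A δ T 1 ≤ T) :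
    P {ω | ¬ ∀ B, IsOLS (fun t => state A g t ω) T B →
      opNorm (B - A) ≤ 8 * Real.sqrt (10 * blockComplexity A δ T 1 / T)} ≤ ENNReal.ofReal δ := by
  have hT0 : (0 : ℝ) < T := by exact_mod_cast hT
  obtain ⟨hL0, hLK, hK25⟩ := log_confidence_bounds hd hT A hδ hδ'
  set K := blockComplexity A δ T 1
  set L := Real.log (5 ^ d / (δ / 6)) +
      Real.log ((gramian A T).det * (T / (δ / 6) + T / 8) ^ d / (T / 8) ^ d) / 2 with hL
  have hpd := posDef_gramian A hT
  have hAc : Measurable (Matrix.toEuclideanCLM (n := Fin d) (𝕜 := ℝ) A) := by fun_prop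
  -- the two self-normalized events and the noise covariance event
  have hE1 := hg.measure_not_selfNormalized_le hd
    (Z := fun t ω => Matrix.toEuclideanCLM (n := Fin d) (𝕜 := ℝ) A (state A g t ω))
    (hg.isNonanticipating 0 fun t => hAc.comp (measurable_state_history A t)) hT hpd
    (fun w => norm_sq_le_dotProduct_gramian A hT w) (by
      intro t ht w
      simp only [inner_toEuclideanCLM]
      rw [hg.lintegral_inner_state_sq]
      refine ENNReal.ofReal_le_ofReal ?_
      refine le_trans ?_ (dotProduct_gramian_mono A (show t + 1 ≤ T from ht) w)
      rw [dotProduct_gramian_succ]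
      exact le_add_of_nonneg_right (sq_nonneg _))
    (ε := δ / 6) (κ := T / 8) (by positivity) (by positivity)
  have hE2 := (hg.shift 1).measure_not_selfNormalized_le hd
    (Z := fun t ω => state A g (t + 1) ω)
    (hg.isNonanticipating 1 fun t => measurable_state_history A (t + 1)) hT hpd
    (fun w => norm_sq_le_dotProduct_gramian A hT w) (by
      intro t ht w
      rw [hg.lintegral_inner_state_sq]
      exact ENNReal.ofReal_le_ofReal (dotProduct_gramian_mono A (show t + 1 ≤ T from ht) w))
    (ε := δ / 6) (κ := T / 8) (by positivity) (by positivity)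
  have hE3 := hg.measure_not_sum_sq_ge_le (Finset.range T)
  simp only [Finset.card_range, finrank_euclideanSpace_fin] at hE3
  rw [← hL] at hE1 hE2
  set S1 := {ω | ¬ ∀ w : EuclideanSpace ℝ (Fin d), ‖∑ t ∈ Finset.range T, inner ℝ w
    (Matrix.toEuclideanCLM (n := Fin d) (𝕜 := ℝ) A (state A g t ω)) • g t ω‖ ^ 2 ≤
    8 * L * (∑ t ∈ Finset.range T, inner ℝ w
      (Matrix.toEuclideanCLM (n := Fin d) (𝕜 := ℝ) A (state A g t ω)) ^ 2 + T / 8 * ‖w‖ ^ 2)}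
    with hS1
  set S2 := {ω | ¬ ∀ w : EuclideanSpace ℝ (Fin d), ‖∑ t ∈ Finset.range T, inner ℝ w
    (state A g (t + 1) ω) • g (t + 1) ω‖ ^ 2 ≤
    8 * L * (∑ t ∈ Finset.range T, inner ℝ w (state A g (t + 1) ω) ^ 2 + T / 8 * ‖w‖ ^ 2)}
    with hS2
  set S3 := {ω | ¬ ∀ v : EuclideanSpace ℝ (Fin d), 1 / 2 * (T : ℝ) * ‖v‖ ^ 2 ≤
    ∑ t ∈ Finset.range T, inner ℝ v (g t ω) ^ 2} with hS3
  have hP3 : P S3 ≤ ENNReal.ofReal (δ / 3) := by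
    rw [← ofReal_measureReal]
    refine ENNReal.ofReal_le_ofReal (hE3.trans ?_)
    have h1 : Real.exp (-(T / 512 : ℝ)) ≤ Real.exp (-Real.log (12 * 25 ^ d / δ)) :=
      Real.exp_le_exp.mpr (by linarith)
    rw [Real.exp_neg (Real.log _), Real.exp_log (by positivity)] at h1
    calc _ ≤ 4 * 25 ^ d * (12 * 25 ^ d / δ)⁻¹ := by gcongr
      _ = δ / 3 := by field_simp; norm_num
  have hsub : {ω | ¬ ∀ B, IsOLS (fun t => state A g t ω) T B →
      opNorm (B - A) ≤ 8 * Real.sqrt (10 * K / T)} ⊆ S1 ∪ S2 ∪ S3 := by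
    intro ω hω
    by_contra hcon
    apply hω
    simp only [hS1, hS2, hS3, Set.mem_union, Set.mem_ofPred_eq, not_or, not_not] at hcon
    obtain ⟨⟨c1, c2⟩, c3⟩ := hcon
    intro B hB
    have hV : ∀ w : EuclideanSpace ℝ (Fin d), 1 / 4 * (T : ℝ) * ‖w‖ ^ 2 ≤
        ∑ t ∈ Finset.range T, inner ℝ w (state A g (t + 1) ω) ^ 2 := fun w =>
      sum_inner_add_sq_ge T
        (fun t => Matrix.toEuclideanCLM (n := Fin d) (𝕜 := ℝ) A (state A g t ω))
        (fun t => g t ω) hL0 (by linarith) w (c3 w) (c1 w)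
    refine (hB.opNorm_sub_le hT A (fun t => g t ω) (fun t => rfl) hL0 hV c2).trans ?_
    gcongr
  refine (measure_mono hsub).trans ((measure_union_le _ _).trans ?_)
  have h12 := (measure_union_le (μ := P) S1 S2).trans (add_le_add hE1 hE2)
  calc P (S1 ∪ S2) + P S3 ≤ (ENNReal.ofReal (2 * (δ / 6)) + ENNReal.ofReal (2 * (δ / 6))) +
        ENNReal.ofReal (δ / 3) := add_le_add h12 hP3
    _ = ENNReal.ofReal δ := by
        rw [← ENNReal.ofReal_add (by positivity) (by positivity),
          ← ENNReal.ofReal_add (by positivity) (by positivity)]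
        congr 1; ring

theorem map_inner_multivariateGaussian {σ : ℝ} (u : EuclideanSpace ℝ (Fin d)) :
    (multivariateGaussian 0 (σ ^ 2 • (1 : Matrix (Fin d) (Fin d) ℝ))).map (fun x => inner ℝ u x) =
      gaussianReal 0 (Real.toNNReal (σ ^ 2 * ‖u‖ ^ 2)) := by
  have hS : (σ ^ 2 • (1 : Matrix (Fin d) (Fin d) ℝ)).PosSemidef :=
    Matrix.PosSemidef.one.smul (sq_nonneg σ)
  set μ := multivariateGaussian 0 (σ ^ 2 • (1 : Matrix (Fin d) (Fin d) ℝ)) with hμ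
  have h := IsGaussian.map_eq_gaussianReal (μ := μ) (innerSL ℝ u)
  have hmean : μ[innerSL ℝ u] = 0 := by
    have := (innerSL ℝ u).integral_comp_id_comm (μ := μ) IsGaussian.integrable_id
    rw [this]
    simp [hμ]
  have hvar : Var[innerSL ℝ u; μ] = σ ^ 2 * ‖u‖ ^ 2 := by
    have h1 := covarianceBilin_self (μ := μ) IsGaussian.memLp_two_id u
    rw [hμ, covarianceBilin_multivariateGaussian hS] at h1
    have h2 : u.ofLp ⬝ᵥ ((σ ^ 2 • (1 : Matrix (Fin d) (Fin d) ℝ)) *ᵥ u.ofLp) =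
        σ ^ 2 * ‖u‖ ^ 2 := by
      rw [Matrix.smul_mulVec, Matrix.one_mulVec, dotProduct_smul, EuclideanSpace.real_norm_sq_eq]
      simp [dotProduct, sq]
    rw [← h2, h1]
    rfl
  rw [hmean, hvar] at h
  exact h

/-- The given noise is only almost everywhere measurable, so measurable versions are rescaled;
countably many exceptional null sets are discarded. -/
theorem IsGaussianNoise.exists_isStdNoise {σ : ℝ} (hσ : 0 < σ)
    {η : ℕ → Ω → EuclideanSpace ℝ (Fin d)} (hη : IsGaussianNoise P σ η) :
    ∃ g : ℕ → Ω → EuclideanSpace ℝ (Fin d), IsStdNoise P g ∧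
      ∀ᵐ ω ∂P, ∀ t, g t ω = σ⁻¹ • η t ω := by
  have hm : ∀ t, AEMeasurable (η t) P := fun t => (hη.law t).aemeasurable
  refine ⟨fun t ω => σ⁻¹ • (hm t).mk (η t) ω, ⟨fun t => ?_, ?_, fun t u => ?_⟩, ?_⟩
  · have := (hm t).measurable_mk
    fun_prop
  · have h1 : iIndepFun (fun t => (hm t).mk (η t)) P :=
      (iIndepFun_congr fun t => (hm t).ae_eq_mk).mp hη.indep
    exact h1.comp (fun _ x => σ⁻¹ • x) fun _ => by fun_prop
  · have h1 : P.map ((hm t).mk (η t)) =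
        multivariateGaussian 0 (σ ^ 2 • (1 : Matrix (Fin d) (Fin d) ℝ)) := by
      rw [← (hη.law t).map_eq]; exact Measure.map_congr (hm t).ae_eq_mk.symm
    have h2 : (fun ω => inner ℝ u (σ⁻¹ • (hm t).mk (η t) ω)) =
        (fun x => inner ℝ (σ⁻¹ • u) x) ∘ (hm t).mk (η t) := by
      ext ω; simp [real_inner_smul_left, real_inner_smul_right]
    rw [h2, ← Measure.map_map (by fun_prop) (hm t).measurable_mk, h1,
      map_inner_multivariateGaussian]
    congr 1
    ext
    rw [Real.coe_toNNReal _ (by positivity), norm_smul, mul_pow, ← mul_assoc]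
    have : σ ^ 2 * ‖σ⁻¹‖ ^ 2 = 1 := by
      rw [Real.norm_eq_abs, sq_abs]; field_simp
    rw [this]; simp
  · rw [ae_all_iff]
    intro t
    filter_upwards [(hm t).ae_eq_mk] with ω hω
    rw [hω]

theorem state_smul (A : Matrix (Fin d) (Fin d) ℝ) {c : ℝ}
    {η : ℕ → Ω → EuclideanSpace ℝ (Fin d)} {ω : Ω} (h : ∀ t, g t ω = c • η t ω) (t : ℕ) :
    state A g t ω = c • state A η t ω := by
  induction t with
  | zero => simp [state]
  | succ t ih => simp only [state, ih, h, map_smul, smul_add]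

/-- Scaling multiplies the objective by `c²`; this is why `σ` is absent from the error bound. -/
theorem IsOLS.smul {x : ℕ → EuclideanSpace ℝ (Fin d)} {T : ℕ} {B : Matrix (Fin d) (Fin d) ℝ}
    (hB : IsOLS x T B) (c : ℝ) : IsOLS (fun t => c • x t) T B := by
  intro M hM
  have h := hB hM
  simp only [Set.mem_ofPred_eq] at h ⊢
  have e : ∀ N : Matrix (Fin d) (Fin d) ℝ, ∑ t ∈ Finset.Icc 1 T, (1 / 2 : ℝ) *
      ‖c • x (t + 1) - Matrix.toEuclideanCLM (n := Fin d) (𝕜 := ℝ) N (c • x t)‖ ^ 2 =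
      c ^ 2 * ∑ t ∈ Finset.Icc 1 T, (1 / 2 : ℝ) *
        ‖x (t + 1) - Matrix.toEuclideanCLM (n := Fin d) (𝕜 := ℝ) N (x t)‖ ^ 2 := by
    intro N
    rw [Finset.mul_sum]
    refine Finset.sum_congr rfl fun t _ => ?_
    rw [map_smul, ← smul_sub, norm_smul, mul_pow, Real.norm_eq_abs, sq_abs]; ring
  rw [e, e]
  gcongr

theorem IsGaussianNoise.measure_opNorm_gt_le [IsProbabilityMeasure P] (hd : 1 ≤ d) {σ : ℝ}
    (hσ : 0 < σ) {η : ℕ → Ω → EuclideanSpace ℝ (Fin d)} (hη : IsGaussianNoise P σ η)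
    (A : Matrix (Fin d) (Fin d) ℝ) {T : ℕ} (hT : 1 ≤ T)
    {δ : ℝ} (hδ : 0 < δ) (hδ' : δ < 1 / 2) (hadm : 5120 * blockComplexity A δ T 1 ≤ T)
    {Ahat : Ω → Matrix (Fin d) (Fin d) ℝ}
    (hAhat : ∀ᵐ ω ∂P, IsOLS (fun t => state A η t ω) T (Ahat ω)) :
    P {ω | 8 * Real.sqrt (10 * blockComplexity A δ T 1 / T) < opNorm (Ahat ω - A)} ≤
      ENNReal.ofReal δ := by
  obtain ⟨g, hg, hgη⟩ := hη.exists_isStdNoise hσ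
  refine le_trans (measure_mono_ae ?_) (hg.measure_not_ols_bound_le hd A hT hδ hδ' hadm)
  filter_upwards [hgη, hAhat] with ω h1 h2 h3 h4
  have h5 : IsOLS (fun t => state A g t ω) T (Ahat ω) := by
    have := h2.smul σ⁻¹
    simpa only [state_smul A h1] using this
  exact absurd (h4 (Ahat ω) h5) (not_le.mpr h3)

end

/-! ### Consistency and assembly -/

theorem tendsto_add_mul_log_div_atTop (a b : ℝ) :
    Tendsto (fun T : ℕ => (a + b * Real.log T) / T) atTop (𝓝 0) := by
  have h1 : Tendsto (fun x : ℝ => Real.log x / x) atTop (𝓝 0) :=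
    Real.isLittleO_log_id_atTop.tendsto_div_nhds_zero
  have h2 : Tendsto (fun x : ℝ => a / x + b * (Real.log x / x)) atTop (𝓝 0) := by
    simpa using (tendsto_const_nhds.div_atTop tendsto_id).add (h1.const_mul b)
  refine (h2.comp tendsto_natCast_atTop_atTop).congr fun T => ?_
  simp only [Function.comp_apply]
  ring

theorem JordanDecomposition.rate_eq {d : ℕ} (hd : 1 ≤ d) {A : Matrix (Fin d) (Fin d) ℝ}
    (D : JordanDecomposition A) {T : ℕ} (hT : 1 ≤ T) {δ : ℝ} (hδ : 0 < δ) :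
    d * Real.log (d * T * condNumber D.S / δ) + Real.log T * D.sumSqTwo =
      d * Real.log (d * condNumber D.S / δ) + (d + D.sumSqTwo) * Real.log T := by
  have hc := zero_lt_one.trans_le (D.one_le_condNumber hd)
  have hT0 : (0 : ℝ) < T := by exact_mod_cast hT
  have hd0 : (0 : ℝ) < d := by exact_mod_cast hd
  rw [show d * T * condNumber D.S / δ = d * condNumber D.S / δ * T by ring,
    Real.log_mul (by positivity) (by positivity)]
  ring

theorem mainTheorem8 :
    ∃ C : ℝ, 0 < C ∧ ∀ c₀ : ℝ, 0 < c₀ → ∃ c : ℝ, 0 < c ∧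
      ∀ (d : ℕ), 1 ≤ d → ∀ (A : Matrix (Fin d) (Fin d) ℝ), MarginallyStable A →
      ∀ D : JordanDecomposition A,
        -- every such block length is admissible
        (∀ (T k : ℕ) (δ : ℝ), 0 < δ → δ < 1 / 2 → 1 ≤ k → k ≤ T →
          c * (d * Real.log (d * condNumber D.S * T / (k * δ)) + Real.log T * D.sumSqTwo)
            ≤ (T : ℝ) / k →
          IsAdmissibleBlockLength c₀ A δ T k) ∧
        -- after the burn-in, the block length one is admissible and gives the error rate
        (∀ (T : ℕ) (δ : ℝ), 0 < δ → δ < 1 / 2 →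
          c * (d * Real.log (d * condNumber D.S / δ) + D.sumSq * Real.log D.sumSq) ≤ (T : ℝ) →
          IsAdmissibleBlockLength c₀ A δ T 1 ∧
          ∀ {Ω : Type u} [MeasurableSpace Ω] (P : Measure Ω) [IsProbabilityMeasure P]
            (σ : ℝ) (η : ℕ → Ω → EuclideanSpace ℝ (Fin d))
            (Ahat : Ω → Matrix (Fin d) (Fin d) ℝ),
            0 < σ → IsGaussianNoise P σ η →
            (∀ᵐ ω ∂P, IsOLS (fun t => state A η t ω) T (Ahat ω)) →
            P {ω | C * Real.sqrt ((d * Real.log (d * T * condNumber D.S / δ)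
                + Real.log T * D.sumSqTwo) / T) < opNorm (Ahat ω - A)} ≤ ENNReal.ofReal δ) ∧
        -- consistency
        (∀ {Ω : Type u} [MeasurableSpace Ω] (P : Measure Ω) [IsProbabilityMeasure P]
          (σ : ℝ) (η : ℕ → Ω → EuclideanSpace ℝ (Fin d))
          (Ahat : ℕ → Ω → Matrix (Fin d) (Fin d) ℝ),
          0 < σ → IsGaussianNoise P σ η →
          (∀ T, ∀ᵐ ω ∂P, IsOLS (fun t => state A η t ω) T (Ahat T ω)) →
          ∀ ε : ℝ, 0 < ε →
            Tendsto (fun T => P {ω | ε < opNorm (Ahat T ω - A)}) atTop (𝓝 0)) := by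
  -- `48 = 8 · 6`, where `10 · 3 ≤ 6²` under the square root.
  refine ⟨48, by norm_num, fun c₀ hc₀ => ?_⟩
  -- One burn-in yields admissibility with `c₀` and with the constant `5120` of the error bound; the
  -- `3` is that of `blockComplexity_le`.
  obtain ⟨c, hc, hburn⟩ := exists_burnIn_constant (c₁ := 3 * (c₀ + 5120)) (by positivity)
  refine ⟨3 * c₀ + c, by positivity, fun d hd A hA D => ?_⟩
  have hrate : ∀ (T : ℕ) (δ : ℝ), 0 < δ → δ < 1 / 2 →
      (3 * c₀ + c) * (d * Real.log (d * condNumber D.S / δ) + D.sumSq * Real.log D.sumSq)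
        ≤ (T : ℝ) →
      IsAdmissibleBlockLength c₀ A δ T 1 ∧
      ∀ {Ω : Type u} [MeasurableSpace Ω] (P : Measure Ω) [IsProbabilityMeasure P]
        (σ : ℝ) (η : ℕ → Ω → EuclideanSpace ℝ (Fin d))
        (Ahat : Ω → Matrix (Fin d) (Fin d) ℝ),
        0 < σ → IsGaussianNoise P σ η →
        (∀ᵐ ω ∂P, IsOLS (fun t => state A η t ω) T (Ahat ω)) →
        P {ω | 48 * Real.sqrt ((d * Real.log (d * T * condNumber D.S / δ)
            + Real.log T * D.sumSqTwo) / T) < opNorm (Ahat ω - A)} ≤ ENNReal.ofReal δ := by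
    intro T δ hδ hδ' hT
    have hU : 0 ≤ d * Real.log (d * condNumber D.S / δ) + D.sumSq * Real.log D.sumSq := by
      have h1 := D.half_le_log hd hδ hδ'
      have h2 : 1 ≤ D.sumSq := le_trans (by exact_mod_cast hd) D.le_sumSq
      have h3 := mul_nonneg (zero_le_one.trans h2) (Real.log_nonneg h2)
      linarith
    obtain ⟨hT1, hT2⟩ := hburn d hd A D T δ hδ hδ'
      (le_trans (mul_le_mul_of_nonneg_right (by linarith) hU) hT)
    have hT3 : 3 * (c₀ + 5120) * (d * Real.log (d * condNumber D.S * T / ((1 : ℕ) * δ)) +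
        Real.log T * D.sumSqTwo) ≤ (T : ℝ) / (1 : ℕ) := by simpa using hT2
    have hK := D.blockComplexity_le hd hA le_rfl hT1 hδ hδ'
    refine ⟨isAdmissibleBlockLength_of_mul_le hd hA D hc₀ (by linarith) hδ hδ' le_rfl hT1 hT3, ?_⟩
    intro Ω _ P _ σ η Ahat hσ hη hAhat
    have hadm : 5120 * blockComplexity A δ T 1 ≤ T := by
      have := (isAdmissibleBlockLength_of_mul_le hd hA D (c₀ := 5120) (by norm_num) (by linarith)
        hδ hδ' le_rfl hT1 hT3).2.2
      simpa [blockComplexity] using this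
    refine (measure_mono fun ω hω => ?_).trans
      (hη.measure_opNorm_gt_le hd hσ A hT1 hδ hδ' hadm hAhat)
    simp only [Set.mem_ofPred_eq] at hω ⊢
    refine lt_of_le_of_lt ?_ hω
    have hT0 : (0 : ℝ) < T := by exact_mod_cast hT1
    rw [show (d : ℝ) * condNumber D.S * T / ((1 : ℕ) * δ) = d * T * condNumber D.S / δ by
      push_cast; ring] at hK
    set R := d * Real.log (d * T * condNumber D.S / δ) + Real.log T * D.sumSqTwo
    calc 8 * Real.sqrt (10 * blockComplexity A δ T 1 / T)
        ≤ 8 * Real.sqrt (6 ^ 2 * (R / T)) := by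
          have hK0 : 0 ≤ blockComplexity A δ T 1 := by
            have := (log_confidence_bounds hd hT1 A hδ hδ')
            linarith [this.1, this.2.1]
          have h36 : 10 * blockComplexity A δ T 1 / T ≤ 6 ^ 2 * (R / T) := by
            rw [← mul_div_assoc]
            exact div_le_div_of_nonneg_right (by linarith) hT0.le
          gcongr
      _ = 48 * Real.sqrt (R / T) := by
          rw [Real.sqrt_mul (by norm_num), Real.sqrt_sq (by norm_num)]; ring
  refine ⟨fun T k δ hδ hδ' hk hkT h =>
    isAdmissibleBlockLength_of_mul_le hd hA D hc₀ (by linarith) hδ hδ' hk hkT h, hrate, ?_⟩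
  intro Ω _ P _ σ η Ahat hσ hη hAhat ε hε
  rw [ENNReal.tendsto_atTop_zero]
  intro e he
  -- The confidence level is fixed below the target probability and does not vary with `T`.
  obtain ⟨δ, hδ, hδ', hδe⟩ : ∃ δ : ℝ, 0 < δ ∧ δ < 1 / 2 ∧ ENNReal.ofReal δ ≤ e := by
    rcases eq_or_ne e ⊤ with rfl | hetop
    · exact ⟨1 / 4, by norm_num, by norm_num, le_top⟩
    · have := ENNReal.toReal_pos he.ne' hetop
      refine ⟨min e.toReal (1 / 4), by positivity,
        lt_of_le_of_lt (min_le_right _ _) (by norm_num), ?_⟩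
      exact ENNReal.ofReal_le_of_le_toReal (min_le_left _ _)
  have ev1 : ∀ᶠ T : ℕ in atTop, (3 * c₀ + c) * (d * Real.log (d * condNumber D.S / δ) +
      D.sumSq * Real.log D.sumSq) ≤ (T : ℝ) :=
    tendsto_natCast_atTop_atTop.eventually_ge_atTop _
  have ev2 : ∀ᶠ T : ℕ in atTop, 48 * Real.sqrt ((d * Real.log (d * condNumber D.S / δ) +
      (d + D.sumSqTwo) * Real.log T) / T) ≤ ε := by
    have h := ((tendsto_add_mul_log_div_atTop (d * Real.log (d * condNumber D.S / δ))
      (d + D.sumSqTwo)).sqrt).const_mul 48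
    rw [Real.sqrt_zero, mul_zero] at h
    exact h.eventually_le_const hε
  obtain ⟨N, hN⟩ := eventually_atTop.mp (ev1.and (ev2.and (eventually_ge_atTop 1)))
  refine ⟨N, fun T hT => ?_⟩
  obtain ⟨h1, h2, h3⟩ := hN T hT
  refine le_trans (measure_mono fun ω hω => ?_)
    (((hrate T δ hδ hδ' h1).2 P σ η (Ahat T) hσ hη (hAhat T)).trans hδe)
  simp only [Set.mem_ofPred_eq] at hω ⊢
  rw [D.rate_eq hd h3 hδ]
  exact h2.trans_lt hω
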